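/- All graphs are finite, simple and undirected. For a graph $G$ let $n(G)$ be its order and let $c_{\rm ind}(G)$ be the maximum order of an induced $2$-regular subgraph of $G$. A graph is $4$-chordal if it has no induced cycle of length more than $4$. Let $P_m$ and $K_m$ denote the path and the complete graph of order $m$, let $K_{3,3}$ be the complete bipartite graph with two parts of order $3$, and let $\Box$ denote the Cartesian product. Let $D$ be $K_4$ minus an edge, and let $D'$ arise from $D$ by adding a new vertex and joining it to the two vertices of degree $2$ in $D$. Let $B_3''$ arise from $P_2\,\Box\,P_3$ by adding two new vertices, one joined to the two vertices of one of the two end copies of $P_2$ and the other joined to the two vertices of the other end copy. Let $G$ be a connected cubic $4$-chordal graph that is not isomorphic to $K_4$, $K_{3,3}$, or $P_2\,\Box\,K_3$. Then $$c_{\rm ind}(G)\ \geq\ \frac{5}{8}\,n(G)+\frac{3}{4}.$$ Furthermore, equality holds if and only if $G$ arises from a tree $T$ of order at least $2$ and maximum degree at most $3$ by replacing every endvertex of $T$ with $D'$, every vertex of $T$ of degree $2$ with $B_3''$, and every vertex of $T$ of degree $3$ with $K_3$. Here, $G$ arises from $T$ by replacing each vertex $w$ of $T$ with a graph $H_w$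 if $V(G)$ can be partitioned into sets $V_w$, $w\in V(T)$, such that $G[V_w]$ is isomorphic to $H_w$ for every $w$, there is exactly one edge of $G$ between $V_u$ and $V_w$ if $uw\in E(T)$, and there is no edge of $G$ between $V_u$ and $V_w$ if $u\neq w$ and $uw\notin E(T)$. -/

import Mathlib

namespace IndTwoReg

universe u v

open SimpleGraph

/-- `G` is `k`-chordal: it has no induced cycle of length more than `k`
(intended for `3 ≤ k`; `G ↪g H` is an embedding as an induced subgraph). -/
def IsKChordal {V : Type u} (k : ℕ) (G : SimpleGraph V) : Prop :=
  ∀ m : ℕ, k < m → IsEmpty (cycleGraph m ↪g G)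

open Classical in
/-- The finite vertex set `S` induces a `2`-regular subgraph of `G`. -/
def InducesTwoRegular {V : Type u} [Fintype V] (G : SimpleGraph V) (S : Finset V) : Prop :=
  (G.induce (S : Set V)).IsRegularOfDegree 2

open Classical in
/-- `c_ind(G)`: the maximum order of an induced `2`-regular subgraph of `G`
(the empty set counts, with order `0`). -/
noncomputable def cInd {V : Type u} [Fintype V] (G : SimpleGraph V) : ℕ :=
  (Finset.univ.filter fun S : Finset V => InducesTwoRegular G S).sup Finset.card

/-- The graph that arises from `G` by adding one new vertex, the vertex `none`, and joining it to
exactly the vertices in `S`. -/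
def addVertex {V : Type u} (G : SimpleGraph V) (S : Set V) : SimpleGraph (Option V) where
  Adj x y := (∃ a b : V, x = some a ∧ y = some b ∧ G.Adj a b) ∨
    (∃ a ∈ S, x = some a ∧ y = none) ∨ (∃ a ∈ S, x = none ∧ y = some a)
  symm := ⟨by
    rintro x y (⟨a, b, hx, hy, h⟩ | ⟨a, ha, hx, hy⟩ | ⟨a, ha, hx, hy⟩)
    · exact Or.inl ⟨b, a, hy, hx, h.symm⟩
    · exact Or.inr (Or.inr ⟨a, ha, hy, hx⟩)
    · exact Or.inr (Or.inl ⟨a, ha, hy, hx⟩)⟩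
  loopless := ⟨by
    rintro x (⟨a, b, hx, hy, h⟩ | ⟨a, _, hx, hy⟩ | ⟨a, _, hx, hy⟩)
    · rw [hx] at hy
      cases hy
      exact G.loopless.irrefl a h
    · rw [hx] at hy
      cases hy
    · rw [hx] at hy
      cases hy⟩

/-- The complete graph `K_m`. -/
abbrev K (m : ℕ) : SimpleGraph (Fin m) := completeGraph (Fin m)

/-- The complete bipartite graph `K_{3,3}`. -/
abbrev K33 : SimpleGraph (Fin 3 ⊕ Fin 3) := completeBipartiteGraph (Fin 3) (Fin 3)

/-- The prism `P_2 □ K_3`. -/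
abbrev prism : SimpleGraph (Fin 2 × Fin 3) := pathGraph 2 □ K 3

/-- The diamond `D`: the graph `K_4` minus the edge between `2` and `3`. -/
def diamond : SimpleGraph (Fin 4) := (K 4).deleteEdges {s(2, 3)}

/-- The graph `D'`: a new vertex is added to `D` and joined to the two vertices of degree `2`. -/
def diamond' : SimpleGraph (Option (Fin 4)) := addVertex diamond {2, 3}

/-- The ladder `B_k = P_2 □ P_k`. -/
abbrev ladder (k : ℕ) : SimpleGraph (Fin 2 × Fin k) := pathGraph 2 □ pathGraph k

/-- `B_k'`: a new vertex is added to `B_k` and joined to the two (adjacent) vertices at its first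
end. -/
def ladder' (k : ℕ) : SimpleGraph (Option (Fin 2 × Fin k)) :=
  addVertex (ladder k) {x | x.2.val = 0}

/-- `B_k''`: a new vertex is added to `B_k'` and joined to the two (adjacent) vertices at the last
end of `B_k`. -/
def ladder'' (k : ℕ) : SimpleGraph (Option (Option (Fin 2 × Fin k))) :=
  addVertex (ladder' k) {y | ∃ x : Fin 2 × Fin k, x.2.val + 1 = k ∧ y = some x}

/-- `G` arises from `T` by replacing every vertex `w` of `T` with the subgraph of `G` induced by
the fibre `f ⁻¹' {w}`: every edge `u w` of `T` becomes exactly one edge of `G` between the fibres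
of `u` and of `w`, and `G` has no other edges between different fibres. -/
structure IsReplacement {W : Type v} {V : Type u} (T : SimpleGraph W) (G : SimpleGraph V)
    (f : V → W) : Prop where
  edge : ∀ u w : W, T.Adj u w → ∃! e : V × V, f e.1 = u ∧ f e.2 = w ∧ G.Adj e.1 e.2
  adj_of_ne : ∀ x y : V, G.Adj x y → f x ≠ f y → T.Adj (f x) (f y)

/-- The subgraph of `G` induced by the fibre of `f` over `w` is (isomorphic to) `H`. -/
def FibreIs {W : Type v} {V : Type u} {X : Type} (G : SimpleGraph V) (f : V → W) (w : W)
    (H : SimpleGraph X) : Prop :=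
  Nonempty (G.induce (f ⁻¹' {w}) ≃g H)

open Classical in
/-- `G` arises from a tree `T` of order at least `2` and maximum degree at most `3` by replacing
every endvertex with `D'`, every vertex of degree `2` with `B_3''`, and every vertex of degree `3`
with `K_3`. -/
def ArisesFromTree {V : Type u} (G : SimpleGraph V) : Prop :=
  ∃ (m : ℕ) (T : SimpleGraph (Fin m)) (f : V → Fin m),
    T.IsTree ∧ 2 ≤ m ∧ (∀ w, T.degree w ≤ 3) ∧ IsReplacement T G f ∧
    (∀ w, T.degree w = 1 → FibreIs G f w diamond') ∧
    (∀ w, T.degree w = 2 → FibreIs G f w (ladder'' 3)) ∧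
    (∀ w, T.degree w = 3 → FibreIs G f w (K 3))

end IndTwoReg

/-! Write n for the order of the graph and measure an induced 2-regular set S by 8|S|; the target is
8|S| ≥ 5n + 6. A branch is one side A of a bridge, and its root u is the end of the bridge in A. The
inductive claim (`IsBranch.bounds`) is that A contains a set of weight at least 5|A| + 7 and a set
avoiding u of weight at least 5|A| - 1, and that both bounds can be tight only if A is assembled
from copies of D', B_3'' and K_3 in a tree-like way. At a bridge, a free choice on one side is
compatible with a choice avoiding the root on the other, and 7 - 1 = 6. In the case of equality both
ways of combining are tight, so all four bounds are, both sides arise from trees, and the bridge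
glues them (`IsTreePart.glue`).

Bridges come from 4-chordality: if an edge is not a bridge, a shortest path around it closes to a
long hole unless the edge lies in a triangle or a 4-cycle (`edge_cases`). If no edge is a bridge,
this local condition leaves only K_4, K_{3,3} and the prism (`exists_isBranch_of_not_special`). The
same dichotomy describes a branch near its root: the root splits off two branches, or its neighbours
form a K_{2,3} configuration with it, or a ladder starts there. A ladder ends in a triangle with one
branch or in two branches (`RungEnd.cases`), and along it three lower bounds evolve by a simple
recursion that is periodic of period three up to slack (`RungEnd.ladderState`).

For the upper bound in a graph arising from a tree, every edge between two fibres is a bridge, so by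
parity no such edge has both ends in S. An inequality checked on each of the three pieces
(`PieceInequality`) is summed over the tree, whose edge count turns the sum into 8|S| ≤ 5n + 6
(`TwoReg.card_le`). -/

namespace IndTwoReg

open SimpleGraph

/-! ### Cubic graphs, 2-regular sets, and sets with one or two leaving edges. -/

section Basics

variable {V : Type*} {G : SimpleGraph V}

/-- Every vertex of `S` has exactly two neighbours in `S`. -/
def TwoReg (G : SimpleGraph V) (S : Finset V) : Prop :=
  ∀ v ∈ S, ∃ x ∈ S, ∃ y ∈ S, x ≠ y ∧ G.Adj v x ∧ G.Adj v y ∧ ∀ z ∈ S, G.Adj v z → z = x ∨ z = y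

/-- The neighbours of `v` are the three distinct vertices `x`, `y` and `z`. -/
structure Nbrs (G : SimpleGraph V) (v x y z : V) : Prop where
  ne₁ : x ≠ y
  ne₂ : x ≠ z
  ne₃ : y ≠ z
  adj : ∀ w, G.Adj v w ↔ w = x ∨ w = y ∨ w = z

/-- Every vertex has exactly three neighbours. -/
def Cubic (G : SimpleGraph V) : Prop := ∀ v, ∃ x y z, Nbrs G v x y z

/-- The only edge leaving `A` is the edge between `u ∈ A` and `x ∉ A`. -/
structure IsBranch (G : SimpleGraph V) (A : Finset V) (u x : V) : Prop where
  mem : u ∈ A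
  notMem : x ∉ A
  adj : G.Adj u x
  out : ∀ v ∈ A, ∀ w ∉ A, G.Adj v w → v = u ∧ w = x

/-- `a` and `b` are adjacent vertices of `B`, and the only edges leaving `B` are those from `a` to
`a₀` and from `b` to `b₀`. -/
structure RungEnd (G : SimpleGraph V) (B : Finset V) (a b a₀ b₀ : V) : Prop where
  mem₁ : a ∈ B
  mem₂ : b ∈ B
  notMem₁ : a₀ ∉ B
  notMem₂ : b₀ ∉ B
  adj : G.Adj a b
  adj₁ : G.Adj a a₀
  adj₂ : G.Adj b b₀
  out : ∀ v ∈ B, ∀ w ∉ B, G.Adj v w → v = a ∧ w = a₀ ∨ v = b ∧ w = b₀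

lemma cubic_of_isRegularOfDegree [Fintype V] [DecidableRel G.Adj]
    (h : G.IsRegularOfDegree 3) : Cubic G := by
  classical
  intro v
  obtain ⟨x, y, z, hxy, hxz, hyz, hs⟩ := Finset.card_eq_three.1 (h v)
  refine ⟨x, y, z, hxy, hxz, hyz, fun w => ?_⟩
  rw [← mem_neighborFinset, hs]
  simp

lemma Cubic.third (h : Cubic G) {v x y : V} (hx : G.Adj v x) (hy : G.Adj v y) (hxy : x ≠ y) :
    ∃ z, Nbrs G v x y z := by
  obtain ⟨p, q, r, h1, h2, h3, hadj⟩ := h v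
  have hx' := (hadj x).1 hx
  have hy' := (hadj y).1 hy
  have key : ∀ z, z ≠ x → z ≠ y → (z = p ∨ z = q ∨ z = r) → ∃ z, Nbrs G v x y z := by
    intro z hzx hzy hz
    refine ⟨z, hxy, hzx.symm, hzy.symm, fun w => ?_⟩
    rw [hadj]
    grind
  by_cases hp : p = x ∨ p = y
  · by_cases hq : q = x ∨ q = y
    · exact key r (by grind) (by grind) (by grind)
    · exact key q (by grind) (by grind) (by grind)
  · exact key p (by grind) (by grind) (by grind)

lemma Cubic.others (h : Cubic G) {v x : V} (hx : G.Adj v x) : ∃ y z, Nbrs G v x y z := by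
  obtain ⟨p, q, r, h1, h2, h3, hadj⟩ := h v
  have : ∃ y, G.Adj v y ∧ x ≠ y := by
    by_cases hp : x = p
    · exact ⟨q, (hadj q).2 (by grind), by grind⟩
    · exact ⟨p, (hadj p).2 (by grind), hp⟩
  obtain ⟨y, hy, hxy⟩ := this
  exact ⟨y, h.third hx hy hxy⟩

lemma TwoReg.union [DecidableEq V] {S T : Finset V} (hS : TwoReg G S) (hT : TwoReg G T)
    (hST : ∀ v ∈ S, ∀ w ∈ T, ¬ G.Adj v w) : TwoReg G (S ∪ T) := by
  intro v hv
  rcases Finset.mem_union.1 hv with hv | hv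
  · obtain ⟨x, hx, y, hy, hxy, h1, h2, h3⟩ := hS v hv
    refine ⟨x, Finset.mem_union_left _ hx, y, Finset.mem_union_left _ hy, hxy, h1, h2, ?_⟩
    intro z hz hvz
    rcases Finset.mem_union.1 hz with hz | hz
    · exact h3 z hz hvz
    · exact absurd hvz (hST v hv z hz)
  · obtain ⟨x, hx, y, hy, hxy, h1, h2, h3⟩ := hT v hv
    refine ⟨x, Finset.mem_union_right _ hx, y, Finset.mem_union_right _ hy, hxy, h1, h2, ?_⟩
    intro z hz hvz
    rcases Finset.mem_union.1 hz with hz | hz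
    · exact absurd hvz.symm (hST z hz v hv)
    · exact h3 z hz hvz

/-- The set `Q` contains a set of order at least `t / 8` that induces a `2`-regular subgraph. -/
def Packs (G : SimpleGraph V) (Q : Finset V) (t : ℤ) : Prop :=
  ∃ S ⊆ Q, TwoReg G S ∧ t ≤ 8 * S.card

/-- `Q` and `R` are disjoint, and no edge joins them. -/
def Sep (G : SimpleGraph V) (Q R : Finset V) : Prop :=
  ∀ v ∈ Q, ∀ w ∈ R, v ≠ w ∧ ¬ G.Adj v w

lemma Packs.mono {Q R : Finset V} {s t : ℤ} (h : Packs G Q t) (hQR : Q ⊆ R) (hst : s ≤ t) :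
    Packs G R s := by
  obtain ⟨S, hS, h1, h2⟩ := h
  exact ⟨S, hS.trans hQR, h1, hst.trans h2⟩

lemma Packs.union [DecidableEq V] {Q R : Finset V} {s t : ℤ} (h : Packs G Q s)
    (h' : Packs G R t) (hQR : Sep G Q R) : Packs G (Q ∪ R) (s + t) := by
  obtain ⟨S, hS, h1, h2⟩ := h
  obtain ⟨T, hT, h3, h4⟩ := h'
  refine ⟨S ∪ T, Finset.union_subset_union hS hT,
    h1.union h3 fun v hv w hw => (hQR v (hS hv) w (hT hw)).2, ?_⟩
  rw [Finset.card_union_of_disjoint]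
  · push_cast; linarith
  · rw [Finset.disjoint_left]
    intro v hv hv'
    exact (hQR v (hS hv) v (hT hv')).1 rfl

lemma packs_triangle [DecidableEq V] {a b c : V} (hab : G.Adj a b) (hac : G.Adj a c)
    (hbc : G.Adj b c) : Packs G {a, b, c} 24 := by
  have h1 := hab.ne
  have h2 := hac.ne
  have h3 := hbc.ne
  refine ⟨_, Finset.Subset.refl _, ?_, ?_⟩
  · intro v hv
    have hs := G.symm.symm
    simp only [Finset.mem_insert, Finset.mem_singleton] at hv
    rcases hv with rfl | rfl | rfl
    · refine ⟨b, by simp, c, by simp, h3, hab, hac, ?_⟩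
      intro z hz hvz
      have := hvz.ne
      grind
    · refine ⟨a, by simp, c, by simp, h2, hab.symm, hbc, ?_⟩
      intro z hz hvz
      have := hvz.ne
      grind
    · refine ⟨a, by simp, b, by simp, h1, hac.symm, hbc.symm, ?_⟩
      intro z hz hvz
      have := hvz.ne
      grind
  · rw [Finset.card_eq_three.2 ⟨a, b, c, h1, h2, h3, rfl⟩]; norm_num

lemma packs_square [DecidableEq V] {a b c d : V} (hab : G.Adj a b) (hbc : G.Adj b c)
    (hcd : G.Adj c d) (hda : G.Adj d a) (hac : ¬ G.Adj a c) (hbd : ¬ G.Adj b d) (h1 : a ≠ c)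
    (h2 : b ≠ d) : Packs G {a, b, c, d} 32 := by
  have h3 := hab.ne
  have h4 := hbc.ne
  have h5 := hcd.ne
  have h6 := hda.ne
  have hac' : ¬ G.Adj c a := fun h => hac h.symm
  have hbd' : ¬ G.Adj d b := fun h => hbd h.symm
  refine ⟨_, Finset.Subset.refl _, ?_, ?_⟩
  · intro v hv
    simp only [Finset.mem_insert, Finset.mem_singleton] at hv
    rcases hv with rfl | rfl | rfl | rfl
    · refine ⟨b, by simp, d, by simp, h2, hab, hda.symm, ?_⟩
      intro z hz hvz
      have := hvz.ne
      grind
    · refine ⟨a, by simp, c, by simp, h1, hab.symm, hbc, ?_⟩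
      intro z hz hvz
      have := hvz.ne
      grind
    · refine ⟨b, by simp, d, by simp, h2, hbc.symm, hcd, ?_⟩
      intro z hz hvz
      have := hvz.ne
      grind
    · refine ⟨a, by simp, c, by simp, h1, hda, hcd.symm, ?_⟩
      intro z hz hvz
      have := hvz.ne
      grind
  · have : ({a, b, c, d} : Finset V).card = 4 := by
      rw [Finset.card_insert_of_notMem, Finset.card_insert_of_notMem,
        Finset.card_insert_of_notMem, Finset.card_singleton] <;> grind
    rw [this]; norm_num

/-- In a connected graph, a set without leaving edges is empty or contains all vertices. -/
lemma eq_empty_of_closed (hG : G.Connected) {D : Finset V} {z : V} (hz : z ∉ D)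
    (h : ∀ v ∈ D, ∀ w, G.Adj v w → w ∈ D) : D = ∅ := by
  rw [Finset.eq_empty_iff_forall_notMem]
  intro v hv
  obtain ⟨p⟩ := hG.preconnected v z
  refine hz ?_
  clear hz
  induction p with
  | nil => exact hv
  | cons hadj _ ih => exact ih (h _ hv _ hadj)

/-- An edge leaving `A` starts in `C` and an edge leaving `C` ends outside `A`, so no edge leaves `A
\ C`; the vertex `z` lies outside this difference, and connectedness makes it empty. -/
lemma subset_of_boundary [DecidableEq V] (hG : G.Connected) {A C : Finset V} {z : V}
    (hz : z ∈ C ∨ z ∉ A)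
    (h₁ : ∀ v ∈ A, ∀ w ∉ A, G.Adj v w → v ∈ C)
    (h₂ : ∀ v ∈ C, ∀ w ∉ C, G.Adj v w → w ∉ A) : A ⊆ C := by
  have : A \ C = ∅ := by
    refine eq_empty_of_closed hG (z := z) (by grind) ?_
    intro v hv w hvw
    have h1 := h₁ v (by grind) w
    have h2 := fun hw => h₂ w hw v (by grind) hvw.symm
    grind
  exact Finset.sdiff_eq_empty_iff_subset.1 this

namespace IsBranch

/-- A branch is determined by its bridge. An explicit description of `A` can therefore be verified
by inspecting only the edges that leave the described set. -/
lemma unique [DecidableEq V] (hG : G.Connected) {A C : Finset V} {u x : V} (hA : IsBranch G A u x)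
    (hC : IsBranch G C u x) : A = C := by
  have := hA.mem
  have := hC.mem
  have := hA.notMem
  have := hC.notMem
  have h1 := hA.out
  have h2 := hC.out
  apply Finset.Subset.antisymm
  · exact subset_of_boundary hG (z := u) (by grind) (by grind) (by grind)
  · exact subset_of_boundary hG (z := u) (by grind) (by grind) (by grind)

/-- A neighbour of an outer vertex is an outer vertex, except across the edge that leaves. -/
lemma notMem_of_adj {A : Finset V} {u x v w : V} (hA : IsBranch G A u x) (hv : v ∉ A)
    (hvw : G.Adj v w) (h : w ≠ u ∨ v ≠ x) : w ∉ A := by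
  intro hw
  have := hA.out w hw v hv hvw.symm
  grind

/-- An edge leaving `A ∩ C` leaves one of the two sets, and since `x ∉ C` and `y ∉ A` it leaves
both, so the two bridges would coincide. -/
lemma disjoint [DecidableEq V] (hG : G.Connected) {A C : Finset V} {u x v y : V}
    (hA : IsBranch G A u x) (hC : IsBranch G C v y) (hx : x ∉ C) (hy : y ∉ A)
    (h : u ≠ v ∨ x ≠ y) : Disjoint A C := by
  rw [Finset.disjoint_iff_inter_eq_empty]
  refine eq_empty_of_closed hG (z := x) (by grind) ?_
  intro p hp q hpq
  have h1 := hA.out p (by grind) q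
  have h2 := hC.out p (by grind) q
  have h3 := hC.out u
  have h4 := hA.adj
  grind

lemma subset [DecidableEq V] (hG : G.Connected) {A C : Finset V} {u x v y : V}
    (hA : IsBranch G A u x) (hC : IsBranch G C v y) (hv : v ∈ A) (hu : u ∉ C) :
    C ⊆ A := by
  have h1 := hA.out
  have h2 := hC.out
  refine subset_of_boundary hG (z := v) (by grind) (by grind) fun p hp q hq hpq hqC => ?_
  have := h2 q hqC p
  have := hpq.symm
  grind

/-- This lemma and `sep` are the two ways to combine a branch with the rest: dropping `u`, or
staying away from `x`, removes the only edge out of `A`. -/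
lemma sep_erase [DecidableEq V] {A Q : Finset V} {u x : V} (hA : IsBranch G A u x)
    (hQ : ∀ v ∈ Q, v ∉ A) : Sep G Q (A.erase u) := by
  intro v hv w hw
  have h1 := hQ v hv
  have h2 := hA.out w (by grind) v h1
  refine ⟨by grind, fun h => ?_⟩
  have := h2 h.symm
  grind

lemma sep {A Q : Finset V} {u x : V} (hA : IsBranch G A u x)
    (hQ : ∀ v ∈ Q, v ∉ A ∧ v ≠ x) : Sep G Q A := by
  intro v hv w hw
  have h1 := hQ v hv
  have h2 := hA.out w hw v h1.1
  refine ⟨by grind, fun h => ?_⟩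
  have := h2 h.symm
  grind

end IsBranch

lemma RungEnd.unique [DecidableEq V] (hG : G.Connected) {A C : Finset V} {a b a₀ b₀ : V}
    (hA : RungEnd G A a b a₀ b₀) (hC : RungEnd G C a b a₀ b₀) : A = C := by
  obtain ⟨_, _, _, _, _, _, _, h1⟩ := hA
  obtain ⟨_, _, _, _, _, _, _, h2⟩ := hC
  apply Finset.Subset.antisymm
  · exact subset_of_boundary hG (z := a) (by grind) (by grind) (by grind)
  · exact subset_of_boundary hG (z := a) (by grind) (by grind) (by grind)

end Basics

/-! ### Long holes, shortest paths, and bridges. -/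

section Holes

variable {V : Type*} {G : SimpleGraph V}

lemma cycleGraph_adj_iff_val (n : ℕ) (u v : Fin (n + 3)) :
    (cycleGraph (n + 3)).Adj u v ↔ u.val + 1 = v.val ∨ v.val + 1 = u.val ∨
      (u.val = 0 ∧ v.val = n + 2) ∨ (v.val = 0 ∧ u.val = n + 2) := by
  rw [cycleGraph_adj']
  have hu := u.isLt
  have hv := v.isLt
  rcases lt_trichotomy u v with h | h | h
  · have h' : u.val < v.val := h
    rw [Fin.sub_val_of_le h.le, Fin.coe_sub_iff_lt.2 h]
    omega
  · subst h
    rw [sub_self, Fin.val_zero]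
    omega
  · have h' : v.val < u.val := h
    rw [Fin.sub_val_of_le h.le, Fin.coe_sub_iff_lt.2 h]
    omega

/-- An injective family of `n + 3 ≥ 5` vertices whose adjacencies are exactly those of a cycle
cannot occur in a `4`-chordal graph. -/
lemma IsKChordal.false_of_cycle (hch : IsKChordal 4 G) {n : ℕ} (hn : 2 ≤ n) (φ : ℕ → V)
    (hinj : ∀ i j, i < j → j < n + 3 → φ i ≠ φ j)
    (hadj : ∀ i j, i < j → j < n + 3 → (G.Adj (φ i) (φ j) ↔ i + 1 = j ∨ (i = 0 ∧ j = n + 2))) :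
    False := by
  refine (hch (n + 3) (by omega)).false ⟨⟨fun i => φ i.val, ?_⟩, ?_⟩
  · intro i j hij
    rcases lt_trichotomy i.val j.val with h | h | h
    · exact absurd hij (hinj _ _ h j.isLt)
    · exact Fin.ext h
    · exact absurd hij.symm (hinj _ _ h i.isLt)
  · intro i j
    change G.Adj (φ i.val) (φ j.val) ↔ _
    rw [cycleGraph_adj_iff_val]
    rcases lt_trichotomy i.val j.val with h | h | h
    · rw [hadj _ _ h j.isLt]; omega
    · obtain rfl := Fin.ext h
      simp only [SimpleGraph.irrefl, false_iff]
      omega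
    · rw [G.adj_comm, hadj _ _ h i.isLt]; omega

lemma IsKChordal.no_five_cycle (hch : IsKChordal 4 G) {a b c d e : V} (hab : G.Adj a b)
    (hbc : G.Adj b c) (hcd : G.Adj c d) (hde : G.Adj d e) (hea : G.Adj e a) (hac : ¬ G.Adj a c)
    (had : ¬ G.Adj a d) (hbd : ¬ G.Adj b d) (hbe : ¬ G.Adj b e) (hce : ¬ G.Adj c e) : False := by
  have hea' := hea.symm
  have hsymm : ∀ x y, G.Adj x y → G.Adj y x := fun _ _ h => h.symm
  have := hab.ne
  have := hbc.ne
  have := hcd.ne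
  have := hde.ne
  have := hea.ne
  refine hch.false_of_cycle (n := 2) le_rfl
    (fun i => match i with | 0 => a | 1 => b | 2 => c | 3 => d | _ => e) ?_ ?_
  · intro i j hij hj
    interval_cases j <;> interval_cases i <;> grind
  · intro i j hij hj
    interval_cases j <;> interval_cases i <;> simp [*]

lemma IsKChordal.no_six_cycle (hch : IsKChordal 4 G) {a b c d e f : V} (hab : G.Adj a b)
    (hbc : G.Adj b c) (hcd : G.Adj c d) (hde : G.Adj d e) (hef : G.Adj e f) (hfa : G.Adj f a)
    (hac : ¬ G.Adj a c) (had : ¬ G.Adj a d) (hae : ¬ G.Adj a e) (hbd : ¬ G.Adj b d)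
    (hbe : ¬ G.Adj b e) (hbf : ¬ G.Adj b f) (hce : ¬ G.Adj c e) (hcf : ¬ G.Adj c f)
    (hdf : ¬ G.Adj d f) : False := by
  have hfa' := hfa.symm
  have hsymm : ∀ x y, G.Adj x y → G.Adj y x := fun _ _ h => h.symm
  have := hab.ne
  have := hbc.ne
  have := hcd.ne
  have := hde.ne
  have := hef.ne
  have := hfa.ne
  refine hch.false_of_cycle (n := 3) (by norm_num)
    (fun i => match i with | 0 => a | 1 => b | 2 => c | 3 => d | 4 => e | _ => f) ?_ ?_
  · intro i j hij hj
    interval_cases j <;> interval_cases i <;> grind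
  · intro i j hij hj
    interval_cases j <;> interval_cases i <;> simp [*]

/-- Two nonadjacent neighbours of `b` without further common neighbours are not joined by a path
that avoids `b` and the other neighbours of `b`: a shortest one would close to a long hole. -/
lemma IsKChordal.not_reachable (hch : IsKChordal 4 G) {b s t : V} {W : Set V} (hs : s ∈ W)
    (ht : t ∈ W) (hbW : b ∉ W) (hb : ∀ w ∈ W, G.Adj b w ↔ w = s ∨ w = t) (hne : s ≠ t)
    (hst : ¬ G.Adj s t) (hcom : ∀ w ∈ W, G.Adj s w → ¬ G.Adj w t) :
    ¬ (G.induce W).Reachable ⟨s, hs⟩ ⟨t, ht⟩ := by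
  intro hreach
  obtain ⟨p, hp⟩ := hreach.exists_walk_length_eq_dist
  set l := p.length with hl
  have hp0 : p.getVert 0 = ⟨s, hs⟩ := p.getVert_zero
  have hpl : p.getVert l = ⟨t, ht⟩ := p.getVert_length
  -- A repeated vertex or a chord would give a shorter path, so the path is induced.
  have hinj : ∀ i j, i < j → j ≤ l → p.getVert i ≠ p.getVert j := by
    intro i j hij hj heq
    have := dist_le ((p.take i).append ((p.drop j).copy heq.symm rfl))
    simp only [Walk.length_append, Walk.length_copy, Walk.take_length, Walk.drop_length] at this
    omega
  have hstep : ∀ i j, i < j → j ≤ l → (G.induce W).Adj (p.getVert i) (p.getVert j) →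
      i + 1 = j := by
    intro i j hij hj hadj
    have := dist_le ((p.take i).append (Walk.cons hadj (p.drop j)))
    simp only [Walk.length_append, Walk.length_cons, Walk.take_length, Walk.drop_length] at this
    omega
  have hsucc : ∀ i, i < l → (G.induce W).Adj (p.getVert i) (p.getVert (i + 1)) :=
    fun i hi => p.adj_getVert_succ hi
  -- The path has `l + 1` vertices; together with `b` they form a hole of length `l + 2 ≥ 5`.
  have hl3 : 3 ≤ l := by
    by_contra hlt
    have h0 : l ≠ 0 := by
      intro h
      rw [h, hp0] at hpl
      exact hne (congrArg Subtype.val hpl)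
    have h1 : l ≠ 1 := by
      intro h
      have := hsucc 0 (by omega)
      rw [zero_add, ← h, hpl, hp0] at this
      exact hst this
    have h2 : l = 2 := by omega
    have h3 := hsucc 0 (by omega)
    have h4 := hsucc 1 (by omega)
    rw [show 1 + 1 = l by omega, hpl] at h4
    rw [hp0] at h3
    exact hcom _ (p.getVert (0 + 1)).2 h3 h4
  have hval : ∀ i j, i ≤ l → j ≤ l → (p.getVert i).1 = (p.getVert j).1 → i = j := by
    intro i j hi hj h
    have h := Subtype.ext h
    rcases lt_trichotomy i j with h' | h' | h'
    · exact absurd h (hinj _ _ h' hj)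
    · exact h'
    · exact absurd h.symm (hinj _ _ h' hi)
  refine hch.false_of_cycle (n := l - 1) (by omega)
    (fun i => if i ≤ l then (p.getVert i).1 else b) ?_ ?_
  · intro i j hij hj heq
    simp only [if_pos (show i ≤ l by omega)] at heq
    split_ifs at heq with h
    · exact absurd (hval _ _ (by omega) h heq) (by omega)
    · exact hbW (heq ▸ (p.getVert i).2)
  · intro i j hij hj
    simp only [if_pos (show i ≤ l by omega)]
    split_ifs with h
    · constructor
      · intro hadj
        exact Or.inl (hstep i j hij h hadj)
      · rintro (rfl | ⟨-, h'⟩)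
        · exact hsucc i (by omega)
        · omega
    · have h' : j = l + 1 := by omega
      rw [G.adj_comm, hb _ (p.getVert i).2]
      have e0 : (p.getVert i).1 = s ↔ i = 0 := by
        have : s = (p.getVert 0).1 := by rw [hp0]
        exact ⟨fun h => hval _ _ (by omega) (by omega) (h.trans this), fun h => by rw [h, ← this]⟩
      have e1 : (p.getVert i).1 = t ↔ i = l := by
        have : t = (p.getVert l).1 := by rw [hpl]
        exact ⟨fun h => hval _ _ (by omega) (by omega) (h.trans this), fun h => by rw [h, ← this]⟩
      rw [e0, e1]
      omega

open Classical in
/-- The vertices that can be reached from `s` inside `W`. -/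
noncomputable def reach [Fintype V] (G : SimpleGraph V) (W : Set V) (s : V) : Finset V :=
  Finset.univ.filter fun v => ∃ (hs : s ∈ W) (hv : v ∈ W), (G.induce W).Reachable ⟨s, hs⟩ ⟨v, hv⟩

lemma mem_reach [Fintype V] {W : Set V} {s v : V} :
    v ∈ reach G W s ↔
      ∃ (hs : s ∈ W) (hv : v ∈ W), (G.induce W).Reachable ⟨s, hs⟩ ⟨v, hv⟩ := by
  simp [reach]

lemma self_mem_reach [Fintype V] {W : Set V} {s : V} (hs : s ∈ W) : s ∈ reach G W s :=
  mem_reach.2 ⟨hs, hs, Reachable.refl _⟩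

lemma mem_of_mem_reach [Fintype V] {W : Set V} {s v : V} (h : v ∈ reach G W s) : v ∈ W :=
  (mem_reach.1 h).2.1

lemma reach_step [Fintype V] {W : Set V} {s v w : V} (h : v ∈ reach G W s) (hvw : G.Adj v w)
    (hw : w ∈ W) : w ∈ reach G W s := by
  obtain ⟨hs, hv, hr⟩ := mem_reach.1 h
  refine mem_reach.2 ⟨hs, hw, hr.trans (Adj.reachable ?_)⟩
  exact hvw

lemma reach_mono [Fintype V] {W W' : Set V} {s : V} (h : W ⊆ W') : reach G W s ⊆ reach G W' s := by
  intro v hv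
  obtain ⟨hs, hv, hr⟩ := mem_reach.1 hv
  exact mem_reach.2 ⟨h hs, h hv, hr.map (induceHomOfLE G h).toHom⟩

/-- An edge `a b` in no triangle and no `4`-cycle is a bridge. -/
lemma exists_isBranch [Fintype V] (hcub : Cubic G) (hch : IsKChordal 4 G) {a b : V}
    (hab : G.Adj a b) (htri : ∀ w, G.Adj a w → ¬ G.Adj b w)
    (hsq : ∀ p q, G.Adj b q → G.Adj q p → G.Adj p a → p ≠ b → q ≠ a → False) :
    ∃ A, IsBranch G A a b := by
  obtain ⟨t₁, t₂, hn⟩ := hcub.others hab.symm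
  -- A vertex reached from `a` without `b`, `t`, `t'` and adjacent to `t` would give a path from `a`
  -- to `t` avoiding `b` and `t'`, against `not_reachable`. Hence, after deleting `b` and its two
  -- other neighbours, the component of `a` is left only by the edge `a b`.
  have key : ∀ t t', Nbrs G b a t t' → ∀ v, G.Adj v t → v ∉ reach G {w | w ≠ b ∧ w ≠ t ∧ w ≠ t'} a := by
    intro t t' hn v hvt hv
    have h0 := hn.ne₁
    have h1 := hn.ne₂
    have h2 := hn.ne₃
    have hbt : G.Adj b t := (hn.adj t).2 (by simp)
    have hmem : t ∈ reach G {w | w ≠ b ∧ w ≠ t'} a := by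
      refine reach_step (reach_mono ?_ hv) hvt ⟨hbt.ne', h2⟩
      rintro w ⟨h, -, h'⟩
      exact ⟨h, h'⟩
    obtain ⟨hs, ht, hr⟩ := mem_reach.1 hmem
    refine hch.not_reachable (b := b) hs ht (by simp) ?_ h0 ?_ ?_ hr
    · rintro w ⟨-, hw⟩
      rw [hn.adj]
      grind
    · exact fun h => htri t h hbt
    · rintro w ⟨hwb, -⟩ haw hwt
      exact hsq w t hbt hwt.symm haw.symm hwb h0.symm
  have hn' : Nbrs G b a t₂ t₁ :=
    ⟨hn.ne₂, hn.ne₁, hn.ne₃.symm, fun w => by rw [hn.adj]; tauto⟩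
  refine ⟨reach G {w | w ≠ b ∧ w ≠ t₁ ∧ w ≠ t₂} a,
    self_mem_reach ⟨hab.ne, hn.ne₁, hn.ne₂⟩, fun h => (mem_of_mem_reach h).1 rfl, hab, ?_⟩
  intro v hv w hw hvw
  by_cases hwb : w = b
  · subst hwb
    have := mem_of_mem_reach hv
    have := (hn.adj v).1 hvw.symm
    simp only [Set.mem_ofPred_eq] at *
    grind
  · by_cases h1 : w = t₁
    · subst h1
      exact absurd hv (key _ _ hn v hvw)
    · by_cases h2 : w = t₂
      · subst h2
        refine absurd ?_ (key _ _ hn' v hvw)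
        rwa [show {x : V | x ≠ b ∧ x ≠ w ∧ x ≠ t₁} = {x | x ≠ b ∧ x ≠ t₁ ∧ x ≠ w} by
          ext; simp only [Set.mem_ofPred_eq]; tauto]
      · exact absurd (reach_step hv hvw ⟨hwb, h1, h2⟩) hw

end Holes

/-! ### The structure of ladders inside the graph. -/

section Ladders

variable {V : Type*} {G : SimpleGraph V} [Fintype V]

/-- The dichotomy behind all case analyses: an edge seen to lie in no triangle and in no 4-cycle `a
b q p` splits off a branch. -/
lemma edge_cases (hcub : Cubic G) (hch : IsKChordal 4 G) {a b : V} (hab : G.Adj a b) :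
    (∃ A, IsBranch G A a b) ∨ (∃ w, G.Adj a w ∧ G.Adj b w) ∨
      ∃ p q, G.Adj b q ∧ G.Adj q p ∧ G.Adj p a ∧ p ≠ b ∧ q ≠ a := by
  by_contra! h
  obtain ⟨h1, h2, h3⟩ := h
  obtain ⟨A, hA⟩ := exists_isBranch hcub hch hab h2 fun p q h4 h5 h6 h7 h8 => h8 (h3 p q h4 h5 h6 h7)
  exact h1 A hA

/-- The shape of a set `B` that ends in the rung `a b`: a triangle with a branch at its apex, a
rung with two branches, or a rung followed by another rung. -/
lemma RungEnd.cases [DecidableEq V] (hG : G.Connected) (hcub : Cubic G) (hch : IsKChordal 4 G)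
    {B : Finset V} {a b a₀ b₀ : V} (hB : RungEnd G B a b a₀ b₀) :
    (∃ c d A, Nbrs G c a b d ∧ Nbrs G a b a₀ c ∧ Nbrs G b a b₀ c ∧ IsBranch G A d c ∧ a ∉ A ∧
      b ∉ A ∧ B = insert a (insert b (insert c A))) ∨
    (∃ a' b' A₁ A₂, Nbrs G a b a₀ a' ∧ Nbrs G b a b₀ b' ∧ IsBranch G A₁ a' a ∧
      IsBranch G A₂ b' b ∧ b ∉ A₁ ∧ a ∉ A₂ ∧ Disjoint A₁ A₂ ∧
      B = insert a (insert b (A₁ ∪ A₂))) ∨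
    (∃ a' b' B', Nbrs G a b a₀ a' ∧ Nbrs G b a b₀ b' ∧ RungEnd G B' a' b' a b ∧
      B = insert a (insert b B')) := by
  have hsymm : ∀ x y, G.Adj x y → G.Adj y x := fun _ _ h => h.symm
  have hirr : ∀ x, ¬ G.Adj x x := fun _ => G.irrefl
  obtain ⟨ha, hb, ha0, hb0, hab, haa, hbb, hout⟩ := id hB
  have hne := hab.ne
  obtain ⟨a', hna⟩ := hcub.third hab haa (by grind)
  obtain ⟨b', hnb⟩ := hcub.third hab.symm hbb (by grind)
  have haa' : G.Adj a a' := (hna.adj a').2 (by simp)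
  have hbb' : G.Adj b b' := (hnb.adj b').2 (by simp)
  have hna' := hna.adj
  have hnb' := hnb.adj
  have n1 := hna.ne₁
  have n2 := hna.ne₂
  have n3 := hna.ne₃
  have m1 := hnb.ne₁
  have m2 := hnb.ne₂
  have m3 := hnb.ne₃
  have ha'B : a' ∈ B := by
    by_contra h
    have := hout a ha a' h haa'
    grind
  have hb'B : b' ∈ B := by
    by_contra h
    have := hout b hb b' h hbb'
    grind
  by_cases heq : a' = b'
  · left
    subst heq
    obtain ⟨d, hnc⟩ := hcub.third haa'.symm hbb'.symm hab.ne
    have hnc' := hnc.adj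
    have k1 := hnc.ne₁
    have k2 := hnc.ne₂
    have k3 := hnc.ne₃
    have hcd : G.Adj a' d := (hnc.adj d).2 (by simp)
    have hdB : d ∈ B := by
      by_contra h
      have := hout a' ha'B d h hcd
      grind
    have hda : ¬ G.Adj d a := by grind
    have hdb : ¬ G.Adj d b := by grind
    -- A triangle or 4-cycle through the edge from the apex to `d` would need an edge from `d` to
    -- `a`, `b`, `a₀` or `b₀`. The first two have no neighbour left, and edges leaving `B` start
    -- only at `a` and `b`.
    rcases edge_cases hcub hch hcd.symm with ⟨A, hA⟩ | ⟨w, h1, h2⟩ | ⟨p, q, h1, h2, h3, h4, h5⟩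
    · have := hA.mem
      have hc := hA.notMem
      have haA : a ∉ A := hA.notMem_of_adj hc haa'.symm (by grind)
      have hbA : b ∉ A := hA.notMem_of_adj hc hbb'.symm (by grind)
      refine ⟨a', d, A, hnc, hna, hnb, hA, haA, hbA, ?_⟩
      have h0 : a₀ ∉ A := hA.notMem_of_adj haA haa (by grind)
      have h0' : b₀ ∉ A := hA.notMem_of_adj hbA hbb (by grind)
      refine hB.unique hG ⟨by simp, by simp, by grind, by grind, hab, haa, hbb, ?_⟩
      intro v hv w hw hvw
      have := hA.out v
      clear hout
      simp only [Finset.mem_insert, not_or] at hv hw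
      rcases hv with rfl | rfl | rfl | hv <;> grind
    · grind
    · exfalso
      have hq : q = a ∨ q = b := by grind
      have := hout p
      have := hdB
      rcases hq with rfl | rfl
      · have hp : p = a₀ := by grind
        subst hp
        have := hout d hdB p ha0 h3.symm
        grind
      · have hp : p = b₀ := by grind
        subst hp
        have := hout d hdB p hb0 h3.symm
        grind
  by_cases hadj : G.Adj a' b'
  · right; right
    refine ⟨a', b', (B.erase a).erase b, hna, hnb, ?_, by grind⟩
    refine ⟨by grind, by grind, by grind, by grind, hadj, haa'.symm, hbb'.symm, ?_⟩
    intro v hv w hw hvw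
    have := hout v (by grind) w
    grind
  · right; left
    have ha'b : ¬ G.Adj a' b := by grind
    have hb'a : ¬ G.Adj b' a := by grind
    -- A 4-cycle through `a a'` either crosses the boundary of `B` a second time or uses the edge
    -- `a' b'`, which is absent here.
    have hA : ∃ A, IsBranch G A a' a := by
      rcases edge_cases hcub hch haa'.symm with h | ⟨w, h1, h2⟩ | ⟨p, q, h1, h2, h3, h4, h5⟩
      · exact h
      · have := hout a' ha'B w
        grind
      · exfalso
        have hq : q = a₀ ∨ q = b := by grind
        have := hout p
        have := hout a' ha'B
        rcases hq with rfl | rfl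
        · by_cases hp : p ∈ B
          · have := hout p hp q ha0 h2.symm
            grind
          · have := hout a' ha'B p hp h3.symm
            grind
        · have hp : p = b₀ ∨ p = b' := by grind
          rcases hp with rfl | rfl
          · have := hout a' ha'B p hb0 h3.symm
            grind
          · exact hadj h3.symm
    have hA' : ∃ A, IsBranch G A b' b := by
      rcases edge_cases hcub hch hbb'.symm with h | ⟨w, h1, h2⟩ | ⟨p, q, h1, h2, h3, h4, h5⟩
      · exact h
      · have := hout b' hb'B w
        grind
      · exfalso
        have hq : q = b₀ ∨ q = a := by grind
        have := hout p
        have := hout b' hb'B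
        rcases hq with rfl | rfl
        · by_cases hp : p ∈ B
          · have := hout p hp q hb0 h2.symm
            grind
          · have := hout b' hb'B p hp h3.symm
            grind
        · have hp : p = a₀ ∨ p = a' := by grind
          rcases hp with rfl | rfl
          · have := hout b' hb'B p ha0 h3.symm
            grind
          · exact hadj h3
    obtain ⟨A₁, h1⟩ := hA
    obtain ⟨A₂, h2⟩ := hA'
    have b1 : b ∉ A₁ := h1.notMem_of_adj h1.notMem hab (by grind)
    have a2 : a ∉ A₂ := h2.notMem_of_adj h2.notMem hab.symm (by grind)
    refine ⟨a', b', A₁, A₂, hna, hnb, h1, h2, b1, a2,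
      h1.disjoint hG h2 a2 b1 (by grind), ?_⟩
    have c1 : a₀ ∉ A₁ := h1.notMem_of_adj h1.notMem haa (by grind)
    have c2 : b₀ ∉ A₂ := h2.notMem_of_adj h2.notMem hbb (by grind)
    have c3 : a₀ ∉ A₂ := h2.notMem_of_adj a2 haa (by grind)
    have c4 : b₀ ∉ A₁ := h1.notMem_of_adj b1 hbb (by grind)
    have e1 := h1.mem
    have e2 := h2.mem
    refine hB.unique hG ⟨by simp, by simp, by grind, by grind, hab, haa, hbb, ?_⟩
    intro v hv w hw hvw
    have := h1.out v
    have := h2.out v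
    clear hout
    simp only [Finset.mem_insert, Finset.mem_union, not_or] at hv hw
    rcases hv with rfl | rfl | hv | hv <;> grind

/-- A set that ends in a rung gives rise to a bridge. -/
lemma RungEnd.exists_isBranch [DecidableEq V] (hG : G.Connected) (hcub : Cubic G)
    (hch : IsKChordal 4 G) {B : Finset V} {a b a₀ b₀ : V} (hB : RungEnd G B a b a₀ b₀) :
    ∃ A u x, IsBranch G A u x := by
  induction hn : B.card using Nat.strong_induction_on generalizing B a b a₀ b₀ with
  | _ n ih =>
    rcases hB.cases hG hcub hch with ⟨c, d, A, -, -, -, h, -⟩ | ⟨a', b', A₁, A₂, -, -, h, -⟩ |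
      ⟨a', b', B', -, -, h, rfl⟩
    · exact ⟨_, _, _, h⟩
    · exact ⟨_, _, _, h⟩
    · have h1 := h.notMem₁
      have h2 := h.notMem₂
      refine ih _ ?_ h rfl
      have := Finset.card_lt_card (s := B') (t := insert a (insert b B'))
        (Finset.ssubset_iff_of_subset (by grind) |>.2 ⟨a, by simp, h1⟩)
      omega

end Ladders

/-! ### Bridgeless graphs: only the three exceptional graphs occur. -/

section Bridgeless

variable {V : Type*} {G : SimpleGraph V}

/-- The image of `g` is closed under adjacency, so it is a whole component, that is, all of `G`. -/
lemma nonempty_iso_of_closed (hG : G.Connected) {X : Type*} [Nonempty X] {H : SimpleGraph X}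
    (g : X → V) (hinj : Function.Injective g) (hadj : ∀ x y, G.Adj (g x) (g y) ↔ H.Adj x y)
    (hcl : ∀ x w, G.Adj (g x) w → ∃ y, g y = w) : Nonempty (G ≃g H) := by
  have hsurj : Function.Surjective g := by
    intro v
    obtain ⟨p⟩ := hG.preconnected (g (Classical.arbitrary X)) v
    generalize Classical.arbitrary X = x at p
    generalize hu : g x = u at p
    induction p generalizing x with
    | nil => exact ⟨x, hu⟩
    | cons h _ ih =>
      subst hu
      obtain ⟨y, hy⟩ := hcl x _ h
      exact ih y hy
  exact ⟨(RelIso.symm ⟨Equiv.ofBijective g ⟨hinj, hsurj⟩, hadj _ _⟩)⟩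

/-- Every edge lies in a triangle or in a `4`-cycle. -/
def NoBridge (G : SimpleGraph V) : Prop :=
  ∀ a b, G.Adj a b → (∃ w, G.Adj a w ∧ G.Adj b w) ∨
    ∃ p q, G.Adj b q ∧ G.Adj q p ∧ G.Adj p a ∧ p ≠ b ∧ q ≠ a

/-- If `c` and `d` are adjacent, the four vertices form a component `K_4`. Otherwise the third edge
at `c` lies in a 4-cycle, which makes its end also the third neighbour of `d`; the third edge at
that end then lies in no triangle and no 4-cycle. -/
lemma NoBridge.false_of_diamond (hE : NoBridge G) (hG : G.Connected) (hcub : Cubic G)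
    (hK4 : IsEmpty (G ≃g K 4)) {a b c d : V} (hab : G.Adj a b) (hac : G.Adj a c)
    (hbc : G.Adj b c) (had : G.Adj a d) (hbd : G.Adj b d) (hcd : c ≠ d) : False := by
  have hsymm : ∀ x y, G.Adj x y → G.Adj y x := fun _ _ h => h.symm
  have hirr : ∀ x, ¬ G.Adj x x := fun _ => G.irrefl
  have ne1 := hab.ne
  have ne2 := hac.ne
  have ne3 := hbc.ne
  have ne4 := had.ne
  have ne5 := hbd.ne
  have na : ∀ w, G.Adj a w ↔ w = b ∨ w = c ∨ w = d := by
    obtain ⟨e, _, _, _, h⟩ := hcub.third hab hac ne3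
    grind
  have nb : ∀ w, G.Adj b w ↔ w = a ∨ w = c ∨ w = d := by
    obtain ⟨e, _, _, _, h⟩ := hcub.third hab.symm hbc ne2
    grind
  obtain ⟨c', _, _, _, nc⟩ := hcub.third hac.symm hbc.symm ne1
  obtain ⟨d', _, _, _, nd⟩ := hcub.third had.symm hbd.symm ne1
  have hcc : G.Adj c c' := (nc c').2 (by simp)
  by_cases hcd' : G.Adj c d
  · obtain rfl : c' = d := by grind
    obtain rfl : d' = c := by grind
    obtain ⟨φ⟩ := nonempty_iso_of_closed (H := K 4) hG ![a, b, d', c'] (by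
      intro i j hij
      fin_cases i <;> fin_cases j <;> simp_all) (by
      intro i j
      fin_cases i <;> fin_cases j <;> simp_all) (by
      intro i w hw
      have : w = a ∨ w = b ∨ w = d' ∨ w = c' := by
        fin_cases i <;> simp [na, nb, nc, nd] at hw <;> tauto
      rcases this with rfl | rfl | rfl | rfl
      exacts [⟨0, rfl⟩, ⟨1, rfl⟩, ⟨2, rfl⟩, ⟨3, rfl⟩])
    exact hK4.false φ
  · have h1 : G.Adj c' d := by
      rcases hE c c' hcc with ⟨w, h1, h2⟩ | ⟨p, q, h1, h2, h3, h4, h5⟩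
      · grind
      · have hp : p = a ∨ p = b := by grind
        rcases hp with rfl | rfl <;> grind
    obtain rfl : d' = c' := by grind
    obtain ⟨e, _, _, _, ne⟩ := hcub.third hcc.symm h1 hcd
    have hde : G.Adj d' e := (ne e).2 (by simp)
    rcases hE d' e hde with ⟨w, h1, h2⟩ | ⟨p, q, h1, h2, h3, h4, h5⟩
    · grind
    · have hp : p = c ∨ p = d := by grind
      have hq : q = a ∨ q = b := by rcases hp with rfl | rfl <;> grind
      rcases hq with rfl | rfl <;> grind

/-- Otherwise `a a' b' c' c` is an induced 5-cycle. -/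
lemma false_of_triangle_path (hch : IsKChordal 4 G) {a b c a' b' c' : V} (hna : Nbrs G a b c a')
    (hnb : Nbrs G b a c b') (hnc : Nbrs G c a b c') (h1 : a' ≠ b') (h2 : a' ≠ c') (h3 : b' ≠ c')
    (h4 : G.Adj a' b') (h5 : G.Adj b' c') : G.Adj a' c' := by
  by_contra h6
  have hsymm : ∀ x y, G.Adj x y → G.Adj y x := fun _ _ h => h.symm
  have hirr : ∀ x, ¬ G.Adj x x := fun _ => G.irrefl
  obtain ⟨_, _, _, na⟩ := hna
  obtain ⟨_, _, _, nb⟩ := hnb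
  obtain ⟨_, _, _, nc⟩ := hnc
  exact hch.no_five_cycle (a := a) (b := a') (c := b') (d := c') (e := c) (by grind) h4 h5
    (by grind) (by grind) (by grind) (by grind) h6 (by grind) (by grind)

/-- The third neighbours `a'`, `b'`, `c'` are distinct because there is no diamond. The edges `a
a'`, `b b'`, `c c'` lie in 4-cycles, so each of the three is adjacent to another one, and
`false_of_triangle_path` completes the prism. -/
lemma NoBridge.false_of_triangle (hE : NoBridge G) (hG : G.Connected) (hcub : Cubic G)
    (hch : IsKChordal 4 G) (hK4 : IsEmpty (G ≃g K 4)) (hprism : IsEmpty (G ≃g prism)) {a b c : V}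
    (hab : G.Adj a b) (hac : G.Adj a c) (hbc : G.Adj b c) : False := by
  have hsymm : ∀ x y, G.Adj x y → G.Adj y x := fun _ _ h => h.symm
  have hirr : ∀ x, ¬ G.Adj x x := fun _ => G.irrefl
  have ne1 := hab.ne
  have ne2 := hac.ne
  have ne3 := hbc.ne
  obtain ⟨a', hna⟩ := hcub.third hab hac ne3
  obtain ⟨b', hnb⟩ := hcub.third hab.symm hbc ne2
  obtain ⟨c', hnc⟩ := hcub.third hac.symm hbc.symm ne1
  have hna' : Nbrs G a c b a' :=
    ⟨hna.ne₁.symm, hna.ne₃, hna.ne₂, fun w => by rw [hna.adj]; tauto⟩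
  have hnb' : Nbrs G b c a b' :=
    ⟨hnb.ne₁.symm, hnb.ne₃, hnb.ne₂, fun w => by rw [hnb.adj]; tauto⟩
  have hnc' : Nbrs G c b a c' :=
    ⟨hnc.ne₁.symm, hnc.ne₃, hnc.ne₂, fun w => by rw [hnc.adj]; tauto⟩
  have na := hna.adj
  have nb := hnb.adj
  have nc := hnc.adj
  have k1 := hna.ne₂
  have k2 := hna.ne₃
  have k3 := hnb.ne₂
  have k4 := hnb.ne₃
  have k5 := hnc.ne₂
  have k6 := hnc.ne₃
  have haa : G.Adj a a' := (na a').2 (by simp)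
  have hbb : G.Adj b b' := (nb b').2 (by simp)
  have hcc : G.Adj c c' := (nc c').2 (by simp)
  have ne4 := haa.ne
  have ne5 := hbb.ne
  have ne6 := hcc.ne
  have h1 : a' ≠ b' := by
    rintro rfl
    exact hE.false_of_diamond hG hcub hK4 hab hac hbc haa hbb (by grind)
  have h2 : a' ≠ c' := by
    rintro rfl
    exact hE.false_of_diamond hG hcub hK4 hac hab hbc.symm haa hcc (by grind)
  have h3 : b' ≠ c' := by
    rintro rfl
    exact hE.false_of_diamond hG hcub hK4 hbc hab.symm hac.symm hbb hcc (by grind)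
  have e1 : G.Adj a' b' ∨ G.Adj a' c' := by
    rcases hE a a' haa with ⟨w, h1, h2⟩ | ⟨p, q, h1, h2, h3, h4, h5⟩
    · grind
    · have hp : p = b ∨ p = c := by grind
      rcases hp with rfl | rfl <;> grind
  have e2 : G.Adj a' b' ∨ G.Adj b' c' := by
    rcases hE b b' hbb with ⟨w, h1, h2⟩ | ⟨p, q, h1, h2, h3, h4, h5⟩
    · grind
    · have hp : p = a ∨ p = c := by grind
      rcases hp with rfl | rfl <;> grind
  have e3 : G.Adj a' c' ∨ G.Adj b' c' := by
    rcases hE c c' hcc with ⟨w, h1, h2⟩ | ⟨p, q, h1, h2, h3, h4, h5⟩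
    · grind
    · have hp : p = a ∨ p = b := by grind
      rcases hp with rfl | rfl <;> grind
  have f1 := false_of_triangle_path hch hna hnb hnc h1 h2 h3
  have f2 := false_of_triangle_path hch hnb hna hnc' h1.symm h3 h2
  have f3 := false_of_triangle_path hch hna' hnc hnb h2 h1 h3.symm
  have g1 : G.Adj a' b' := by grind
  have g2 : G.Adj a' c' := by grind
  have g3 : G.Adj b' c' := by grind
  have na2 : ∀ w, G.Adj a' w ↔ w = a ∨ w = b' ∨ w = c' := by
    obtain ⟨e, _, _, _, h⟩ := hcub.third g1 g2 h3
    grind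
  have nb2 : ∀ w, G.Adj b' w ↔ w = b ∨ w = a' ∨ w = c' := by
    obtain ⟨e, _, _, _, h⟩ := hcub.third g1.symm g3 h2
    grind
  have nc2 : ∀ w, G.Adj c' w ↔ w = c ∨ w = a' ∨ w = b' := by
    obtain ⟨e, _, _, _, h⟩ := hcub.third g2.symm g3.symm h1
    grind
  obtain ⟨φ⟩ := nonempty_iso_of_closed (H := prism) hG
    (fun x => ![![a, b, c], ![a', b', c']] x.1 x.2) (by
      rintro ⟨i, i'⟩ ⟨j, j'⟩ hij
      fin_cases i <;> fin_cases i' <;> fin_cases j <;> fin_cases j' <;> simp_all) (by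
      rintro ⟨i, i'⟩ ⟨j, j'⟩
      clear hE hna hnb hnc hna' hnb' hnc' e1 e2 e3 f1 f2 f3 hsymm hirr
      fin_cases i <;> fin_cases i' <;> fin_cases j <;> fin_cases j' <;>
        simp [boxProd_adj, pathGraph_adj, na, nb, nc, na2, nb2, nc2] <;> grind) (by
      rintro ⟨i, i'⟩ w hw
      fin_cases i <;> fin_cases i'
      · rcases (na w).1 hw with h | h | h
        exacts [⟨(0, 1), h.symm⟩, ⟨(0, 2), h.symm⟩, ⟨(1, 0), h.symm⟩]
      · rcases (nb w).1 hw with h | h | h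
        exacts [⟨(0, 0), h.symm⟩, ⟨(0, 2), h.symm⟩, ⟨(1, 1), h.symm⟩]
      · rcases (nc w).1 hw with h | h | h
        exacts [⟨(0, 0), h.symm⟩, ⟨(0, 1), h.symm⟩, ⟨(1, 2), h.symm⟩]
      · rcases (na2 w).1 hw with h | h | h
        exacts [⟨(0, 0), h.symm⟩, ⟨(1, 1), h.symm⟩, ⟨(1, 2), h.symm⟩]
      · rcases (nb2 w).1 hw with h | h | h
        exacts [⟨(0, 1), h.symm⟩, ⟨(1, 0), h.symm⟩, ⟨(1, 2), h.symm⟩]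
      · rcases (nc2 w).1 hw with h | h | h
        exacts [⟨(0, 2), h.symm⟩, ⟨(1, 0), h.symm⟩, ⟨(1, 1), h.symm⟩])
  exact hprism.false φ

/-- In a triangle-free graph without bridges, a `K_{2,3}` extends to a component `K_{3,3}`. -/
lemma NoBridge.false_of_two_three (hE : NoBridge G) (hG : G.Connected) (hcub : Cubic G)
    (hK33 : IsEmpty (G ≃g K33)) (htf : ∀ x y z, G.Adj x y → G.Adj x z → ¬ G.Adj y z)
    {a b u x y : V} (hna : Nbrs G a u x y) (hnb : Nbrs G b u x y) (hab : a ≠ b) : False := by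
  have hsymm : ∀ x y, G.Adj x y → G.Adj y x := fun _ _ h => h.symm
  have hirr : ∀ x, ¬ G.Adj x x := fun _ => G.irrefl
  obtain ⟨k1, k2, k3, na⟩ := hna
  obtain ⟨-, -, -, nb⟩ := hnb
  obtain ⟨u', _, l1, l2, nu⟩ := hcub.third (v := u) (x := a) (y := b) (by grind) (by grind) hab
  obtain ⟨x', _, l3, l4, nx⟩ := hcub.third (v := x) (x := a) (y := b) (by grind) (by grind) hab
  obtain ⟨y', _, l5, l6, ny⟩ := hcub.third (v := y) (x := a) (y := b) (by grind) (by grind) hab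
  have huu : G.Adj u u' := (nu u').2 (by simp)
  have hxx : G.Adj x x' := (nx x').2 (by simp)
  have hyy : G.Adj y y' := (ny y').2 (by simp)
  have e1 : u' = x' ∨ u' = y' := by
    rcases hE u u' huu with ⟨w, h1, h2⟩ | ⟨p, q, h1, h2, h3, h4, h5⟩
    · exact absurd h2 (htf _ _ _ huu h1)
    · have hp : p = a ∨ p = b := by grind
      have hq : q = x ∨ q = y := by rcases hp with rfl | rfl <;> grind
      rcases hq with rfl | rfl <;> grind
  have e2 : x' = u' ∨ x' = y' := by
    rcases hE x x' hxx with ⟨w, h1, h2⟩ | ⟨p, q, h1, h2, h3, h4, h5⟩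
    · exact absurd h2 (htf _ _ _ hxx h1)
    · have hp : p = a ∨ p = b := by grind
      have hq : q = u ∨ q = y := by rcases hp with rfl | rfl <;> grind
      rcases hq with rfl | rfl <;> grind
  have e3 : y' = u' ∨ y' = x' := by
    rcases hE y y' hyy with ⟨w, h1, h2⟩ | ⟨p, q, h1, h2, h3, h4, h5⟩
    · exact absurd h2 (htf _ _ _ hyy h1)
    · have hp : p = a ∨ p = b := by grind
      have hq : q = x ∨ q = u := by rcases hp with rfl | rfl <;> grind
      rcases hq with rfl | rfl <;> grind
  obtain rfl : x' = u' := by grind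
  obtain rfl : y' = x' := by grind
  have nz : ∀ w, G.Adj y' w ↔ w = u ∨ w = x ∨ w = y := by
    obtain ⟨e, _, _, _, h⟩ := hcub.third huu.symm hxx.symm k1
    grind
  have t1 := htf a u x
  have t2 := htf a u y
  have t3 := htf a x y
  have ne1 : u ≠ a := by grind
  have ne2 : u ≠ b := by grind
  have ne3 : u ≠ y' := by grind
  have ne4 : x ≠ a := by grind
  have ne5 : x ≠ b := by grind
  have ne6 : x ≠ y' := by grind
  have ne7 : y ≠ a := by grind
  have ne8 : y ≠ b := by grind
  have ne9 : y ≠ y' := by grind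
  obtain ⟨φ⟩ := nonempty_iso_of_closed (H := K33) hG (Sum.elim ![a, b, y'] ![u, x, y]) (by
      clear hE htf t1 t2 t3 e1 e2 e3
      rintro (i | i) (j | j) hij <;> fin_cases i <;> fin_cases j <;> simp_all) (by
      clear hE htf t1 t2 t3 e1 e2 e3
      rintro (i | i) (j | j) <;> fin_cases i <;> fin_cases j <;>
        simp [na, nb, nu, nx, ny, nz] <;> grind) (by
      rintro (i | i) w hw <;> fin_cases i
      · rcases (na w).1 hw with h | h | h
        exacts [⟨.inr 0, h.symm⟩, ⟨.inr 1, h.symm⟩, ⟨.inr 2, h.symm⟩]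
      · rcases (nb w).1 hw with h | h | h
        exacts [⟨.inr 0, h.symm⟩, ⟨.inr 1, h.symm⟩, ⟨.inr 2, h.symm⟩]
      · rcases (nz w).1 hw with h | h | h
        exacts [⟨.inr 0, h.symm⟩, ⟨.inr 1, h.symm⟩, ⟨.inr 2, h.symm⟩]
      · rcases (nu w).1 hw with h | h | h
        exacts [⟨.inl 0, h.symm⟩, ⟨.inl 1, h.symm⟩, ⟨.inl 2, h.symm⟩]
      · rcases (nx w).1 hw with h | h | h
        exacts [⟨.inl 0, h.symm⟩, ⟨.inl 1, h.symm⟩, ⟨.inl 2, h.symm⟩]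
      · rcases (ny w).1 hw with h | h | h
        exacts [⟨.inl 0, h.symm⟩, ⟨.inl 1, h.symm⟩, ⟨.inl 2, h.symm⟩])
  exact hK33.false φ

/-- A vertex outside a `4`-cycle `u a x b` that is joined to two outer neighbours of the cycle. -/
lemma false_of_consecutive (hch : IsKChordal 4 G)
    (htf : ∀ x y z, G.Adj x y → G.Adj x z → ¬ G.Adj y z) {u a x b u' a' x' b' : V}
    (hnu : Nbrs G u a b u') (hna : Nbrs G a u x a') (hnx : Nbrs G x a b x')
    (hnb : Nbrs G b u x b') (hux : u' ≠ x') (hab : a' ≠ b') (h1 : G.Adj u' a')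
    (h2 : G.Adj a' x') : False := by
  have hsymm : ∀ x y, G.Adj x y → G.Adj y x := fun _ _ h => h.symm
  have hirr : ∀ x, ¬ G.Adj x x := fun _ => G.irrefl
  obtain ⟨_, _, _, nu⟩ := hnu
  obtain ⟨_, _, _, na⟩ := hna
  obtain ⟨_, _, _, nx⟩ := hnx
  obtain ⟨_, _, _, nb⟩ := hnb
  have t1 := htf a' u' x' h1.symm h2
  have t2 := htf u u' b
  have t3 := htf x x' b
  exact hch.no_six_cycle (a := u) (b := u') (c := a') (d := x') (e := x) (f := b) (by grind) h1 h2
    (by grind) (by grind) (by grind) (by grind) (by grind) (by grind) t1 (by grind) (by grind)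
    (by grind) (by grind) (by grind)

/-- In a `4`-cycle `u a x b`, the rail edges `u b` and `a x` separate the rungs `u a` and `x b`. -/
lemma exists_rungEnd [Fintype V] (hch : IsKChordal 4 G)
    (htf : ∀ x y z, G.Adj x y → G.Adj x z → ¬ G.Adj y z) {u a x b u' a' x' b' : V}
    (hnu : Nbrs G u a b u') (hna : Nbrs G a u x a') (hnx : Nbrs G x a b x')
    (hnb : Nbrs G b u x b') (hux : u' ≠ x') (hab : a' ≠ b') (h1 : ¬ G.Adj a' x')
    (h2 : ¬ G.Adj u' b') : ∃ B, RungEnd G B u a b x := by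
  have hsymm : ∀ x y, G.Adj x y → G.Adj y x := fun _ _ h => h.symm
  have hirr : ∀ x, ¬ G.Adj x x := fun _ => G.irrefl
  obtain ⟨k1, k2, k3, nu⟩ := hnu
  obtain ⟨k4, k5, k6, na⟩ := hna
  obtain ⟨k7, k8, k9, nx⟩ := hnx
  obtain ⟨k10, k11, k12, nb⟩ := hnb
  have t1 := htf a u x
  have hmem : ∀ w, w ∈ {w : V | w ≠ b ∧ w ≠ x} ↔ w ≠ b ∧ w ≠ x := fun _ => Iff.rfl
  have hu : u ≠ b ∧ u ≠ x := by grind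
  have ha : a ≠ b ∧ a ≠ x := by grind
  have hua : G.Adj u a := by grind
  -- Once `b` and `x` are deleted, a path from `u` to `b'` would close to a hole through `b`, and a
  -- path from `a` to `x'` to a hole through `x`.
  have h3 : b' ∉ reach G {w | w ≠ b ∧ w ≠ x} u := by
    intro h
    obtain ⟨hs, ht, hr⟩ := mem_reach.1 h
    refine hch.not_reachable (b := b) hs ht (by grind) ?_ k11 (htf b u b' (by grind) (by grind)) ?_ hr
    · rintro w hw
      grind
    · intro w hw
      grind
  have h4 : x' ∉ reach G {w | w ≠ b ∧ w ≠ x} u := by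
    intro h
    obtain ⟨hs, ht, hr⟩ := mem_reach.1 h
    have hr' : (G.induce {w | w ≠ b ∧ w ≠ x}).Reachable ⟨a, ha⟩ ⟨x', ht⟩ := by
      refine Reachable.trans (Adj.reachable ?_) hr
      exact hua.symm
    refine hch.not_reachable (b := x) ha ht (by grind) ?_ k8 (htf x a x' (by grind) (by grind)) ?_ hr'
    · rintro w hw
      grind
    · intro w hw
      grind
  have h5 : u ∈ reach G {w | w ≠ b ∧ w ≠ x} u := self_mem_reach hu
  refine ⟨reach G {w | w ≠ b ∧ w ≠ x} u, h5, reach_step h5 hua ha,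
    fun h => (mem_of_mem_reach h).1 rfl, fun h => (mem_of_mem_reach h).2 rfl, hua, by grind,
    by grind, ?_⟩
  intro v hv w hw hvw
  have h6 := mem_of_mem_reach hv
  rw [hmem] at h6
  by_cases hwb : w = b
  · subst hwb
    grind
  · by_cases hwx : w = x
    · subst hwx
      grind
    · exact absurd (reach_step hv hvw ⟨hwb, hwx⟩) hw

/-- Without bridges there are no triangles, so every edge lies in a 4-cycle. The outer neighbours of
a 4-cycle then produce a `K_{3,3}`, a 6-hole, or the end of a ladder, and a ladder end always
contains a branch. -/
lemma exists_isBranch_of_not_special [Fintype V] (hG : G.Connected) (hcub : Cubic G)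
    (hch : IsKChordal 4 G) (hK4 : IsEmpty (G ≃g K 4)) (hK33 : IsEmpty (G ≃g K33))
    (hprism : IsEmpty (G ≃g prism)) : ∃ A u x, IsBranch G A u x := by
  classical
  by_contra! hno
  have hE : NoBridge G := by
    intro a b hab
    rcases edge_cases hcub hch hab with ⟨A, hA⟩ | h | h
    · exact absurd hA (hno _ _ _)
    · exact Or.inl h
    · exact Or.inr h
  have htf : ∀ x y z, G.Adj x y → G.Adj x z → ¬ G.Adj y z := fun x y z h1 h2 h3 =>
    hE.false_of_triangle hG hcub hch hK4 hprism h1 h2 h3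
  have hsymm : ∀ x y, G.Adj x y → G.Adj y x := fun _ _ h => h.symm
  have hirr : ∀ x, ¬ G.Adj x x := fun _ => G.irrefl
  have hrung : ∀ B a b a₀ b₀, ¬ RungEnd G B a b a₀ b₀ := by
    intro B a b a₀ b₀ hB
    obtain ⟨A, u, x, hA⟩ := hB.exists_isBranch hG hcub hch
    exact hno _ _ _ hA
  obtain ⟨u⟩ := hG.nonempty
  obtain ⟨a, _, _, _, _, _, hu⟩ := hcub u
  have hua : G.Adj u a := (hu a).2 (by simp)
  obtain ⟨x, b, hax, hxb, hbu, hxu, hba⟩ :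
      ∃ x b, G.Adj a x ∧ G.Adj x b ∧ G.Adj b u ∧ x ≠ u ∧ b ≠ a := by
    rcases hE u a hua with ⟨w, h1, h2⟩ | ⟨p, q, h1, h2, h3, h4, h5⟩
    · exact absurd h2 (htf _ _ _ hua h1)
    · exact ⟨q, p, h1, h2, h3, h5, h4⟩
  obtain ⟨u', hnu⟩ := hcub.third hua hbu.symm hba.symm
  obtain ⟨a', hna⟩ := hcub.third hua.symm hax hxu.symm
  obtain ⟨x', hnx⟩ := hcub.third hax.symm hxb hba.symm
  obtain ⟨b', hnb⟩ := hcub.third hbu hxb.symm hxu.symm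
  have swap : ∀ {v x y z}, Nbrs G v x y z → Nbrs G v y x z := fun h =>
    ⟨h.ne₁.symm, h.ne₃, h.ne₂, fun w => by rw [h.adj]; tauto⟩
  have hab' : a' ≠ b' := by
    rintro rfl
    exact hE.false_of_two_three hG hcub hK33 htf hna hnb hba.symm
  have hux' : u' ≠ x' := by
    rintro rfl
    exact hE.false_of_two_three hG hcub hK33 htf hnu hnx hxu.symm
  have c1 := false_of_consecutive hch htf hnu hna hnx hnb hux' hab'
  have c2 := false_of_consecutive hch htf (swap hna) hnx (swap hnb) hnu hab' hux'.symm
  have c3 := false_of_consecutive hch htf (swap hnx) (swap hnb) (swap hnu) (swap hna) hux'.symm hab'.symm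
  have c4 := false_of_consecutive hch htf hnb (swap hnu) hna (swap hnx) hab'.symm hux'
  -- Otherwise the edges `u b` and `a x` form a cut and bound a ladder. Any choice from `d1`
  -- together with any choice from `d2` is a path on three outer neighbours, which `c1` to `c4`
  -- exclude.
  have d1 : G.Adj a' x' ∨ G.Adj u' b' := by
    by_contra! h
    obtain ⟨B, hB⟩ := exists_rungEnd hch htf hnu hna hnx hnb hux' hab' h.1 h.2
    exact hrung _ _ _ _ _ hB
  have d2 : G.Adj x' b' ∨ G.Adj a' u' := by
    by_contra! h
    obtain ⟨B, hB⟩ := exists_rungEnd hch htf (swap hna) hnx (swap hnb) hnu hab' hux'.symm h.1 h.2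
    exact hrung _ _ _ _ _ hB
  grind

end Bridgeless

/-! ### The three pieces and tree-like unions of them. -/

section Pieces

/-- The adjacency matrix of `D'`; the vertex `4` is the one of degree `2`. -/
def matD (i j : Fin 5) : Bool :=
  decide ((i.val, j.val) ∈ [(0, 1), (0, 2), (0, 3), (1, 2), (1, 3), (2, 4), (3, 4)]) ||
  decide ((j.val, i.val) ∈ [(0, 1), (0, 2), (0, 3), (1, 2), (1, 3), (2, 4), (3, 4)])

/-- The adjacency matrix of `B_3''`; the vertices `0` and `7` are those of degree `2`. -/
def matB (i j : Fin 8) : Bool :=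
  decide ((i.val, j.val) ∈ [(0, 1), (0, 2), (1, 2), (1, 3), (2, 4), (3, 4), (3, 5), (4, 6), (5, 6),
    (5, 7), (6, 7)]) ||
  decide ((j.val, i.val) ∈ [(0, 1), (0, 2), (1, 2), (1, 3), (2, 4), (3, 4), (3, 5), (4, 6), (5, 6),
    (5, 7), (6, 7)])

/-- The adjacency matrix of `K_3`. -/
def matK (i j : Fin 3) : Bool := i != j

variable {V : Type*} {G : SimpleGraph V}

/-- The set `F` induces a graph with adjacency matrix `M`. -/
def Copy (G : SimpleGraph V) {n : ℕ} (M : Fin n → Fin n → Bool) (F : Set V) : Prop :=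
  ∃ g : Fin n → V, Function.Injective g ∧ Set.range g = F ∧ ∀ i j, G.Adj (g i) (g j) ↔ M i j = true

/-- The set `F` induces `D'`, `B_3''` or `K_3`. -/
def IsPiece (G : SimpleGraph V) (F : Set V) : Prop :=
  Copy G matD F ∨ Copy G matB F ∨ Copy G matK F

@[simp]
lemma addVertex_some_some {X : Type*} (H : SimpleGraph X) (S : Set X) (a b : X) :
    (addVertex H S).Adj (some a) (some b) ↔ H.Adj a b := by
  simp [addVertex]

@[simp]
lemma addVertex_some_none {X : Type*} (H : SimpleGraph X) (S : Set X) (a : X) :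
    (addVertex H S).Adj (some a) none ↔ a ∈ S := by
  simp [addVertex]

@[simp]
lemma addVertex_none_some {X : Type*} (H : SimpleGraph X) (S : Set X) (a : X) :
    (addVertex H S).Adj none (some a) ↔ a ∈ S := by
  simp [addVertex]

lemma nonempty_iso_iff_copy {n : ℕ} {M : Fin n → Fin n → Bool} {X : Type*} {H : SimpleGraph X}
    (e : Fin n → X) (he : Function.Bijective e) (hM : ∀ i j, H.Adj (e i) (e j) ↔ M i j = true)
    (F : Set V) : Nonempty (G.induce F ≃g H) ↔ Copy G M F := by
  constructor
  · rintro ⟨φ⟩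
    refine ⟨fun i => (φ.symm (e i)).1, ?_, ?_, ?_⟩
    · intro i j hij
      exact he.1 (φ.symm.injective (Subtype.ext hij))
    · ext v
      constructor
      · rintro ⟨i, rfl⟩
        exact (φ.symm (e i)).2
      · intro hv
        obtain ⟨i, hi⟩ := he.2 (φ ⟨v, hv⟩)
        exact ⟨i, by simp [hi]⟩
    · intro i j
      rw [← hM, ← φ.symm.map_adj_iff]
      rfl
  · rintro ⟨g, hinj, hrange, hadj⟩
    subst hrange
    refine ⟨⟨(Equiv.ofInjective g hinj).symm.trans (Equiv.ofBijective e he), ?_⟩⟩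
    rintro ⟨_, i, rfl⟩ ⟨_, j, rfl⟩
    have h1 : ∀ i, (Equiv.ofInjective g hinj).symm ⟨g i, i, rfl⟩ = i := fun i => by
      rw [Equiv.symm_apply_eq]; rfl
    simp [h1, hM, hadj]

lemma fibreIs_diamond'_iff {W : Type*} (f : V → W) (w : W) :
    FibreIs G f w diamond' ↔ Copy G matD (f ⁻¹' {w}) := by
  refine nonempty_iso_iff_copy ![some 0, some 1, some 2, some 3, none] ?_ ?_ _
  · constructor
    · decide
    · decide
  · intro i j
    fin_cases i <;> fin_cases j <;> simp [matD, diamond', diamond]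

set_option maxHeartbeats 800000 in
lemma fibreIs_ladder''_iff {W : Type*} (f : V → W) (w : W) :
    FibreIs G f w (ladder'' 3) ↔ Copy G matB (f ⁻¹' {w}) := by
  -- `some none` is the vertex added at the first end of the ladder and `none` the one added at the
  -- last end.
  refine nonempty_iso_iff_copy ![some none, some (some (0, 0)), some (some (1, 0)),
    some (some (0, 1)), some (some (1, 1)), some (some (0, 2)), some (some (1, 2)), none] ?_ ?_ _
  · constructor
    · decide
    · decide
  · intro i j
    fin_cases i <;> fin_cases j <;>
      simp [matB, ladder'', ladder', boxProd_adj, pathGraph_adj]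

lemma fibreIs_K_iff {W : Type*} (f : V → W) (w : W) :
    FibreIs G f w (K 3) ↔ Copy G matK (f ⁻¹' {w}) := by
  refine nonempty_iso_iff_copy id Function.bijective_id ?_ _
  intro i j
  simp [matK]

lemma isPiece_triangle {u a b : V} (h1 : G.Adj u a) (h2 : G.Adj u b) (h3 : G.Adj a b) :
    IsPiece G {u, a, b} := by
  refine Or.inr (Or.inr ⟨![u, a, b], ?_, ?_, ?_⟩)
  · have := h1.ne
    have := h2.ne
    have := h3.ne
    intro i j hij
    fin_cases i <;> fin_cases j <;> simp_all
  · ext v; simp [eq_comm]; tauto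
  · intro i j
    fin_cases i <;> fin_cases j <;> simp [matK, h1, h2, h3, h1.symm, h2.symm, h3.symm]

/-- Adjacency matrices only have to be compared above the diagonal. -/
lemma copy_of_lt {n : ℕ} {M : Fin n → Fin n → Bool} (hM : ∀ i j, M i j = M j i)
    (hM' : ∀ i, M i i = false) {F : Set V} (g : Fin n → V) (hrange : Set.range g = F)
    (hne : ∀ i j, i < j → g i ≠ g j) (h : ∀ i j, i < j → (G.Adj (g i) (g j) ↔ M i j = true)) :
    Copy G M F := by
  refine ⟨g, ?_, hrange, ?_⟩
  · intro i j hij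
    rcases lt_trichotomy i j with h' | h' | h'
    · exact absurd hij (hne _ _ h')
    · exact h'
    · exact absurd hij.symm (hne _ _ h')
  · intro i j
    rcases lt_trichotomy i j with h' | h' | h'
    · exact h _ _ h'
    · subst h'; simp [hM']
    · rw [G.adj_comm, hM]; exact h _ _ h'

lemma isPiece_diamond' {u a b x y : V} (nu : ¬ G.Adj u x ∧ ¬ G.Adj u y) (na : Nbrs G a u x y)
    (nb : Nbrs G b u x y) (hab : a ≠ b) (hxy : G.Adj x y) : IsPiece G {u, a, b, x, y} := by
  obtain ⟨k1, k2, k3, na⟩ := na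
  obtain ⟨-, -, -, nb⟩ := nb
  have hsymm : ∀ x y, G.Adj x y → G.Adj y x := fun _ _ h => h.symm
  have hirr : ∀ x, ¬ G.Adj x x := fun _ => G.irrefl
  refine Or.inl (copy_of_lt (by decide) (by decide) ![x, y, a, b, u] ?_ ?_ ?_)
  · ext v; simp [eq_comm]; tauto
  · intro i j hij
    fin_cases i <;> fin_cases j <;> simp at hij ⊢ <;> grind
  · intro i j hij
    fin_cases i <;> fin_cases j <;> simp [matD] at hij ⊢ <;> grind

lemma isPiece_ladder'' {c a b a₀ b₀ a₁ b₁ u : V} (hc : ∀ w ∈ [a₀, b₀, a₁, b₁, u], ¬ G.Adj c w)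
    (hcu : c ≠ u) (na : Nbrs G a b a₀ c) (nb : Nbrs G b a b₀ c) (na₀ : Nbrs G a₀ a b₀ a₁)
    (nb₀ : Nbrs G b₀ b a₀ b₁) (na₁ : Nbrs G a₁ a₀ b₁ u) (nb₁ : Nbrs G b₁ b₀ a₁ u)
    (hne : [c, a, b, a₀, b₀, a₁, b₁, u].Nodup) :
    IsPiece G {c, a, b, a₀, b₀, a₁, b₁, u} := by
  refine Or.inr (Or.inl (copy_of_lt (by decide) (by decide) ![c, a, b, a₀, b₀, a₁, b₁, u] ?_ ?_ ?_))
  · ext v; simp [eq_comm]; tauto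
  · have := hne
    intro i j hij h
    rw [List.nodup_iff_injective_get] at hne
    have h1 : ∀ k : Fin 8, ![c, a, b, a₀, b₀, a₁, b₁, u] k = [c, a, b, a₀, b₀, a₁, b₁, u].get k := by
      intro k; fin_cases k <;> rfl
    rw [h1, h1] at h
    exact hij.ne (hne h)
  · have hca : G.Adj c a := ((na.adj c).2 (by simp)).symm
    have hcb : G.Adj c b := ((nb.adj c).2 (by simp)).symm
    replace na := na.adj
    replace nb := nb.adj
    replace na₀ := na₀.adj
    replace nb₀ := nb₀.adj
    replace na₁ := na₁.adj
    replace nb₁ := nb₁.adj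
    simp only [List.nodup_cons, List.mem_cons, not_or, List.not_mem_nil] at hne
    simp only [List.mem_cons, List.not_mem_nil, or_false, forall_eq_or_imp, forall_eq] at hc
    have hs : ∀ x y : V, (x = y) = (y = x) := fun _ _ => propext eq_comm
    intro i j hij
    fin_cases i <;> fin_cases j <;> simp [matB] at hij ⊢ <;> simp [*]

/-- The subset `A` of the vertices of `G` arises from a tree by replacing every vertex with `D'`,
`B_3''` or `K_3`. -/
def IsTreePart (G : SimpleGraph V) (A : Finset V) : Prop :=
  ∃ (W : Type) (_ : Finite W) (T : SimpleGraph W) (f : V → W), T.IsTree ∧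
    (∀ w, IsPiece G {v | v ∈ A ∧ f v = w}) ∧
    (∀ u w, T.Adj u w →
      ∃! e : V × V, (e.1 ∈ A ∧ e.2 ∈ A) ∧ f e.1 = u ∧ f e.2 = w ∧ G.Adj e.1 e.2) ∧
    ∀ x ∈ A, ∀ y ∈ A, G.Adj x y → f x ≠ f y → T.Adj (f x) (f y)

lemma IsPiece.isTreePart {A : Finset V} (h : IsPiece G A) : IsTreePart G A :=
  ⟨Unit, inferInstance, ⊥, fun _ => (), IsTree.of_subsingleton, fun w => by simpa using h,
    fun u w h => absurd h (by simp), fun x _ y _ _ h => absurd rfl h⟩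

/-- By counting: two disjoint trees have two edges fewer than vertices, and the new edge connects
them. -/
lemma isTree_sum_sup_edge {W₁ W₂ : Type*} [Finite W₁] [Finite W₂] {T₁ : SimpleGraph W₁}
    {T₂ : SimpleGraph W₂} (h₁ : T₁.IsTree) (h₂ : T₂.IsTree) (r₁ : W₁) (r₂ : W₂) :
    (T₁.sum T₂ ⊔ edge (.inl r₁) (.inr r₂)).IsTree := by
  classical
  have := Fintype.ofFinite W₁
  have := Fintype.ofFinite W₂
  rw [isTree_iff_connected_and_card] at h₁ h₂ ⊢
  refine ⟨Connected.sum_sup_edge h₁.1 h₂.1, ?_⟩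
  have h := card_edgeFinset_sup_edge (G := T₁.sum T₂) (s := .inl r₁) (t := .inr r₂) (by simp)
    (by simp)
  have h' := Nat.card_congr (edgeSetSumEquiv (G := T₁) (H := T₂))
  rw [Nat.card_sum] at h' ⊢
  rw [edgeFinset_card, edgeFinset_card, ← Nat.card_eq_fintype_card, ← Nat.card_eq_fintype_card] at h
  omega

/-- The underlying tree is the sum of the two trees plus an edge between the pieces of `p` and `q`;
by `hu` this edge is represented by `p q` alone. -/
lemma IsTreePart.glue [DecidableEq V] {A₁ A₂ : Finset V} (h₁ : IsTreePart G A₁)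
    (h₂ : IsTreePart G A₂) (hd : Disjoint A₁ A₂) {p q : V} (hp : p ∈ A₁) (hq : q ∈ A₂)
    (hpq : G.Adj p q) (hu : ∀ v ∈ A₁, ∀ w ∈ A₂, G.Adj v w → v = p ∧ w = q) :
    IsTreePart G (A₁ ∪ A₂) := by
  obtain ⟨W₁, _, T₁, f₁, ht₁, hp₁, he₁, ha₁⟩ := h₁
  obtain ⟨W₂, _, T₂, f₂, ht₂, hp₂, he₂, ha₂⟩ := h₂
  have hd' : ∀ v ∈ A₂, v ∉ A₁ := fun v h h' => Finset.disjoint_left.1 hd h' h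
  refine ⟨W₁ ⊕ W₂, inferInstance, _,
    fun v => if v ∈ A₁ then .inl (f₁ v) else .inr (f₂ v),
    isTree_sum_sup_edge ht₁ ht₂ (f₁ p) (f₂ q), ?_, ?_, ?_⟩
  · rintro (w | w)
    · convert hp₁ w using 1
      ext v
      simp only [Set.mem_ofPred_eq, Finset.mem_union]
      by_cases hv : v ∈ A₁ <;> simp [hv]
    · convert hp₂ w using 1
      ext v
      simp only [Set.mem_ofPred_eq, Finset.mem_union]
      by_cases hv : v ∈ A₁
      · simpa [hv] using fun h => absurd hv (hd' v h)
      · simp [hv]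
  · have hcross : ∀ u w, (T₁.sum T₂ ⊔ edge (.inl (f₁ p)) (.inr (f₂ q))).Adj u w →
        (∃ u' w', u = .inl u' ∧ w = .inl w' ∧ T₁.Adj u' w') ∨
        (∃ u' w', u = .inr u' ∧ w = .inr w' ∧ T₂.Adj u' w') ∨
        (u = .inl (f₁ p) ∧ w = .inr (f₂ q)) ∨ (u = .inr (f₂ q) ∧ w = .inl (f₁ p)) := by
      rintro (u | u) (w | w) h <;> simp [edge_adj] at h <;> simp [h]
    intro u w huw
    rcases hcross u w huw with ⟨u, w, rfl, rfl, h⟩ | ⟨u, w, rfl, rfl, h⟩ | ⟨rfl, rfl⟩ | ⟨rfl, rfl⟩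
    · obtain ⟨e, he, heu⟩ := he₁ u w h
      refine ⟨e, by simp [he], ?_⟩
      rintro ⟨x, y⟩ hxy
      apply heu
      obtain ⟨-, h1, h2, h3⟩ := hxy
      dsimp only at h1 h2
      split_ifs at h1 h2 with h6 h7
      exact ⟨⟨h6, h7⟩, Sum.inl.inj h1, Sum.inl.inj h2, h3⟩
    · obtain ⟨e, he, heu⟩ := he₂ u w h
      refine ⟨e, by simp [he, hd' _ he.1.1, hd' _ he.1.2], ?_⟩
      rintro ⟨x, y⟩ hxy
      apply heu
      simp only [Finset.mem_union] at hxy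
      obtain ⟨⟨h4, h5⟩, h1, h2, h3⟩ := hxy
      split_ifs at h1 h2 with h6 h7
      exact ⟨⟨h4.resolve_left h6, h5.resolve_left h7⟩, Sum.inr.inj h1, Sum.inr.inj h2, h3⟩
    · refine ⟨(p, q), by simp [hp, hq, hd' _ hq, hpq], ?_⟩
      rintro ⟨x, y⟩ hxy
      simp only [Finset.mem_union] at hxy
      obtain ⟨⟨h4, h5⟩, h1, h2, h3⟩ := hxy
      split_ifs at h1 h2 with h6 h7
      have := hu x h6 y (by tauto) h3
      simp [this]
    · refine ⟨(q, p), by simp [hp, hq, hd' _ hq, hpq.symm], ?_⟩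
      rintro ⟨x, y⟩ hxy
      simp only [Finset.mem_union] at hxy
      obtain ⟨⟨h4, h5⟩, h1, h2, h3⟩ := hxy
      split_ifs at h1 h2 with h6 h7
      have := hu y h7 x (by tauto) h3.symm
      simp [this]
  · intro x hx y hy hxy
    simp only [Finset.mem_union] at hx hy
    clear he₁ he₂ hp₁ hp₂
    by_cases hx1 : x ∈ A₁ <;> by_cases hy1 : y ∈ A₁
    · simp only [hx1, hy1, if_true]
      intro hne
      have := ha₁ x hx1 y hy1 hxy fun h => hne (congrArg _ h)
      simp [this]
    · obtain ⟨rfl, rfl⟩ := hu x hx1 y (by tauto) hxy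
      simp [hx1, hy1, edge_adj]
    · obtain ⟨rfl, rfl⟩ := hu y hy1 x (by tauto) hxy.symm
      simp [hx1, hy1, edge_adj]
    · simp only [hx1, hy1, if_false]
      intro hne
      have := ha₂ x (by tauto) y (by tauto) hxy fun h => hne (congrArg _ h)
      simp [this]

end Pieces

/-! ### Lower bounds along a ladder. -/

section LadderBounds

variable {V : Type*} {G : SimpleGraph V} [DecidableEq V]

/-- The lower bounds for a branch `A` with root `u`, without and with the condition of avoiding `u`;
they are not both attained unless `A` arises from a tree. -/
def Bounds (G : SimpleGraph V) (A : Finset V) (u : V) : Prop :=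
  ∃ α β : ℤ, 0 ≤ α ∧ 0 ≤ β ∧ Packs G A (5 * A.card + 7 + α) ∧
    Packs G (A.erase u) (5 * A.card - 1 + β) ∧ (IsTreePart G A ∨ 0 < α + β)

/-- Lower bounds for a set `B` that ends in the rung `a b`: avoiding `a`, `b` and their neighbours,
avoiding `a` and `b`, and without restriction. -/
structure LadderBounds (G : SimpleGraph V) (B : Finset V) (a b : V) (p q r : ℤ) : Prop where
  far : ∃ Q ⊆ B, (∀ v ∈ Q, v ≠ a ∧ v ≠ b ∧ ¬ G.Adj v a ∧ ¬ G.Adj v b) ∧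
    Packs G Q (5 * B.card - 10 + p)
  avoid : Packs G ((B.erase a).erase b) (5 * B.card + q)
  all : Packs G B (5 * B.card + r)

/-- Adding `n` rungs and then an apex to `B` yields a set that arises from a tree. -/
def Extends (G : SimpleGraph V) : ℕ → Finset V → V → V → V → V → Prop
  | 0, B, _, _, a₀, b₀ => a₀ = b₀ → IsTreePart G (insert a₀ B)
  | n + 1, B, _, _, a₀, b₀ => ∀ a₁ b₁, RungEnd G (insert a₀ (insert b₀ B)) a₀ b₀ a₁ b₁ →
      Extends G n (insert a₀ (insert b₀ B)) a₀ b₀ a₁ b₁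

/-- The possible lower bounds for a set that ends in a rung. -/
def LadderState (G : SimpleGraph V) (B : Finset V) (a b a₀ b₀ : V) : Prop :=
  (∃ α β : ℤ, 0 ≤ α ∧ 0 ≤ β ∧
    ((LadderBounds G B a b (2 + α) (-8 + α) (8 + β) ∧ (Extends G 2 B a b a₀ b₀ ∨ 0 < α + β)) ∨
     (LadderBounds G B a b (-8 + α) (-2 + β) (14 + α) ∧ (Extends G 1 B a b a₀ b₀ ∨ 0 < α + β)) ∨
     (LadderBounds G B a b (-2 + β) (4 + α) (4 + α) ∧ (Extends G 0 B a b a₀ b₀ ∨ 0 < α + β)))) ∨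
  LadderBounds G B a b 4 (-6) 10 ∨ LadderBounds G B a b (-6) 0 16 ∨ LadderBounds G B a b 0 6 6

lemma card_insert₂ {B : Finset V} {a b : V} (hab : a ≠ b) (ha : a ∉ B) (hb : b ∉ B) :
    ((insert a (insert b B)).card : ℤ) = B.card + 2 := by
  rw [Finset.card_insert_of_notMem (by simp [hab, ha]), Finset.card_insert_of_notMem hb]
  push_cast; ring

lemma LadderBounds.mono {B : Finset V} {a b : V} {p q r p' q' r' : ℤ}
    (h : LadderBounds G B a b p q r) (hp : p' ≤ p) (hq : q' ≤ q) (hr : r' ≤ r) :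
    LadderBounds G B a b p' q' r' := by
  obtain ⟨⟨Q, h1, h2, h3⟩, h4, h5⟩ := h
  exact ⟨⟨Q, h1, h2, h3.mono subset_rfl (by linarith)⟩, h4.mono subset_rfl (by linarith),
    h5.mono subset_rfl (by linarith)⟩

/-- The effect of a further rung on the lower bounds. -/
lemma LadderBounds.step {B : Finset V} {a b a' b' : V} {p q r : ℤ}
    (h : LadderBounds G B a' b' p q r) (hB : RungEnd G B a' b' a b) (hab : G.Adj a b) :
    LadderBounds G (insert a (insert b B)) a b q (r - 10) (max (r - 10) (12 + p)) := by
  obtain ⟨⟨Q, hQ, hQ', h1⟩, h2, h3⟩ := h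
  obtain ⟨m1, m2, m3, m4, hab', haa, hbb, hout⟩ := hB
  have hne := hab.ne
  have hne' := hab'.ne
  have hsymm : ∀ x y, G.Adj x y → G.Adj y x := fun _ _ h => h.symm
  have hc := card_insert₂ hne m3 m4
  -- Two more vertices cost 10. Sets avoiding `a'`, `b'` become far, and arbitrary subsets of `B`
  -- now avoid `a`, `b`. The only new option is the square on the last two rungs with a far set of
  -- `B`, worth 32 - 10 - 10 + p = 12 + p.
  refine ⟨⟨(B.erase a').erase b', by grind, ?_, h2.mono subset_rfl (by linarith)⟩,
    h3.mono (by grind) (by linarith), ?_⟩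
  · intro v hv
    have := hout v (by grind) a m3
    have := hout v (by grind) b m4
    grind
  · rcases max_cases (r - 10) (12 + p) with ⟨h, -⟩ | ⟨h, -⟩ <;> rw [h]
    · exact h3.mono (by grind) (by linarith)
    · have hsq : Packs G {a, b, b', a'} 32 := by
        refine packs_square hab hbb.symm hab'.symm haa ?_ ?_ (by grind) (by grind)
        · intro h
          have := hout b' m2 a m3 h.symm
          grind
        · intro h
          have := hout a' m1 b m4 h.symm
          grind
      refine (hsq.union h1 ?_).mono (by grind) (by linarith)
      intro v hv w hw
      have := hQ' w hw
      have := hout w (hQ hw) a m3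
      have := hout w (hQ hw) b m4
      simp only [Finset.mem_insert, Finset.mem_singleton] at hv
      rcases hv with rfl | rfl | rfl | rfl <;> grind

set_option maxHeartbeats 1000000 in
/-- The vertices of a `B_3''` at the root of a branch. -/
lemma extends_apex (hcub : Cubic G) {A : Finset V} {a b c d a₀ b₀ : V} (hn : Nbrs G c a b d)
    (hA : IsBranch G A d c) (ha : a ∉ A) (hb : b ∉ A)
    (hB : RungEnd G (insert a (insert b (insert c A))) a b a₀ b₀) (hT : IsTreePart G A) :
    Extends G 2 (insert a (insert b (insert c A))) a b a₀ b₀ := by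
  intro a₁ b₁ hB₁ u u' hB₂ huu
  subst huu
  have hsymm : ∀ x y, G.Adj x y → G.Adj y x := fun _ _ h => h.symm
  have hirr : ∀ x, ¬ G.Adj x x := fun _ => G.irrefl
  obtain ⟨p1, p2, p3, p4, p5, p6, p7, p8⟩ := hB
  obtain ⟨-, -, q3, q4, q5, q6, q7, q8⟩ := hB₁
  obtain ⟨-, -, r3, -, r5, r6, r7, r8⟩ := hB₂
  have ne1 := p5.ne
  have ne2 := q5.ne
  have ne3 := r5.ne
  have hac : G.Adj a c := ((hn.adj a).2 (by simp)).symm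
  have hbc : G.Adj b c := ((hn.adj b).2 (by simp)).symm
  have hcA := hA.notMem
  have hdA := hA.mem
  have hcd := hA.adj
  simp only [Finset.mem_insert, not_or] at p3 p4 q3 q4 r3
  obtain ⟨na, hna⟩ := hcub.third p5 p6 (by grind)
  obtain ⟨nb, hnb⟩ := hcub.third p5.symm p7 (by grind)
  obtain ⟨na₀, hna₀⟩ := hcub.third p6.symm q5 (by grind)
  obtain ⟨nb₀, hnb₀⟩ := hcub.third p7.symm q5.symm (by grind)
  obtain ⟨na₁, hna₁⟩ := hcub.third q6.symm r5 (by grind)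
  obtain ⟨nb₁, hnb₁⟩ := hcub.third q7.symm r5.symm (by grind)
  obtain rfl : c = na := by have := hna.adj c; grind
  obtain rfl : c = nb := by have := hnb.adj c; grind
  obtain rfl : a₁ = na₀ := by have := hna₀.adj a₁; grind
  obtain rfl : b₁ = nb₀ := by have := hnb₀.adj b₁; grind
  obtain rfl : u = na₁ := by have := hna₁.adj u; grind
  obtain rfl : u = nb₁ := by have := hnb₁.adj u; grind
  have hnodup : [c, a, b, a₀, b₀, a₁, b₁, u].Nodup := by
    simp only [List.nodup_cons, List.mem_cons, not_or, List.not_mem_nil, not_false_eq_true,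
      List.nodup_nil, and_true]
    grind
  have hpiece := isPiece_ladder'' (c := c) (u := u) (by
    have := hn.adj
    simp only [List.mem_cons, List.not_mem_nil, or_false, forall_eq_or_imp, forall_eq]
    grind) (by grind) hna hnb hna₀ hnb₀ hna₁ hnb₁ hnodup
  have hpart : IsTreePart G {c, a, b, a₀, b₀, a₁, b₁, u} := by
    apply IsPiece.isTreePart
    simpa using hpiece
  have := hpart.glue hT (p := c) (q := d) (by
      rw [Finset.disjoint_left]
      intro v hv
      simp only [Finset.mem_insert, Finset.mem_singleton] at hv
      grind) (by simp) hdA hcd.symm (by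
      intro v hv w hw hvw
      have := hA.out w hw v (by
        simp only [Finset.mem_insert, Finset.mem_singleton] at hv
        grind) hvw.symm
      grind)
  convert this using 1
  ext v
  simp only [Finset.mem_insert, Finset.mem_union, Finset.mem_singleton]
  tauto

lemma extends_sides {A₁ A₂ : Finset V} {a b a' b' a₀ b₀ : V} (h₁ : IsBranch G A₁ a' a)
    (h₂ : IsBranch G A₂ b' b) (hb : b ∉ A₁) (ha : a ∉ A₂) (hd : Disjoint A₁ A₂)
    (hB : RungEnd G (insert a (insert b (A₁ ∪ A₂))) a b a₀ b₀) (hT₁ : IsTreePart G A₁)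
    (hT₂ : IsTreePart G A₂) : Extends G 0 (insert a (insert b (A₁ ∪ A₂))) a b a₀ b₀ := by
  intro heq
  subst heq
  obtain ⟨p1, p2, p3, p4, p5, p6, p7, p8⟩ := hB
  simp only [Finset.mem_insert, Finset.mem_union, not_or] at p3
  have ha1 := h₁.notMem
  have hb2 := h₂.notMem
  have hpart : IsTreePart G {a₀, a, b} := by
    apply IsPiece.isTreePart
    simpa using isPiece_triangle p6.symm p7.symm p5
  have hpart₁ := hpart.glue hT₁ (p := a) (q := a') (by
      rw [Finset.disjoint_left]
      intro v hv
      simp only [Finset.mem_insert, Finset.mem_singleton] at hv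
      grind) (by simp) h₁.mem h₁.adj.symm (by
      intro v hv w hw hvw
      have := h₁.out w hw v (by
        simp only [Finset.mem_insert, Finset.mem_singleton] at hv
        grind) hvw.symm
      grind)
  have hpart₂ := hpart₁.glue hT₂ (p := b) (q := b') (by
      rw [Finset.disjoint_left] at hd ⊢
      intro v hv
      simp only [Finset.mem_insert, Finset.mem_singleton, Finset.mem_union] at hv
      have := @hd v
      grind) (by simp) h₂.mem h₂.adj.symm (by
      intro v hv w hw hvw
      rw [Finset.disjoint_left] at hd
      have := @hd v
      have := h₂.out w hw v (by
        simp only [Finset.mem_insert, Finset.mem_singleton, Finset.mem_union] at hv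
        grind) hvw.symm
      grind)
  convert hpart₂ using 1
  ext v
  simp only [Finset.mem_insert, Finset.mem_union, Finset.mem_singleton]
  tauto

/-- A rung sends (p, q, r) to (q, r - 10, max (r - 10) (12 + p)). An apex gives (2, -8, 8), then
(-8, -2, 14), then (-2, 4, 4), which is also the value for two branches; `Extends` counts the rungs
still missing before an apex completes a tight piece. Further rungs give (4, -6, 10), (-6, 0, 16),
(0, 6, 6), and the next triple dominates (4, -6, 10), so the list is closed. -/
lemma RungEnd.ladderState [Fintype V] (hG : G.Connected) (hcub : Cubic G) (hch : IsKChordal 4 G)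
    {N : ℕ} (hN : ∀ A u x, IsBranch G A u x → A.card < N → Bounds G A u) {B : Finset V}
    {a b a₀ b₀ : V} (hB : RungEnd G B a b a₀ b₀) (hBN : B.card ≤ N) :
    LadderState G B a b a₀ b₀ := by
  induction hn : B.card using Nat.strong_induction_on generalizing B a b a₀ b₀ with
  | _ n ih =>
    have hab := hB.adj
    have hne := hab.ne
    rcases hB.cases hG hcub hch with ⟨c, d, A, hnc, hna, hnb, hA, ha, hb, rfl⟩ |
      ⟨a', b', A₁, A₂, hna, hnb, h₁, h₂, hb, ha, hd, rfl⟩ | ⟨a', b', B', hna, hnb, hB', rfl⟩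
    · have hac : G.Adj a c := (hna.adj c).2 (by simp)
      have hbc : G.Adj b c := (hnb.adj c).2 (by simp)
      have hcA := hA.notMem
      have hac' := hac.ne
      have hbc' := hbc.ne
      have hcard : ((insert a (insert b (insert c A))).card : ℤ) = A.card + 3 := by
        rw [card_insert₂ hne (by grind) (by grind), Finset.card_insert_of_notMem hcA]
        push_cast; ring
      obtain ⟨α, β, hα, hβ, k1, k2, k3⟩ := hN A d c hA (by lia)
      left
      -- With three vertices besides `A`, a free choice in `A` is worth 7 - 15 = -8 and serves for
      -- both restricted bounds. The triangle with a choice avoiding `d` is worth 24 - 1 - 15 = 8.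
      refine ⟨α, β, hα, hβ, Or.inl ⟨⟨⟨A, by grind, ?_, k1.mono subset_rfl (by linarith)⟩,
        k1.mono (by grind) (by linarith), ?_⟩, k3.imp_left fun h => ?_⟩⟩
      · intro v hv
        have h3 := hA.out v hv a ha
        have h4 := hA.out v hv b hb
        grind
      · refine ((packs_triangle hab hac hbc).union k2 (hA.sep_erase ?_)).mono (by grind) (by linarith)
        intro v hv
        simp only [Finset.mem_insert, Finset.mem_singleton] at hv
        grind
      · exact extends_apex hcub hnc hA ha hb hB h
    · have ha1 := h₁.notMem
      have hb2 := h₂.notMem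
      have hcard : ((insert a (insert b (A₁ ∪ A₂))).card : ℤ) = A₁.card + A₂.card + 2 := by
        rw [card_insert₂ hne (by grind) (by grind), Finset.card_union_of_disjoint hd]
        push_cast; ring
      obtain ⟨α₁, β₁, hα₁, hβ₁, k1, k2, k3⟩ := hN A₁ a' a h₁ (by lia)
      obtain ⟨α₂, β₂, hα₂, hβ₂, l1, l2, l3⟩ := hN A₂ b' b h₂ (by lia)
      rw [Finset.disjoint_left] at hd
      have hsep : Sep G A₁ A₂ := h₂.sep fun v hv => ⟨hd hv, by grind⟩
      left
      -- Avoiding both roots is worth -1 - 1 - 10 = -10 - 2, and free choices on both sides 7 + 7 -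
      -- 10 = 4.
      refine ⟨α₁ + α₂, β₁ + β₂, by linarith, by linarith, Or.inr (Or.inr ⟨⟨⟨A₁.erase a' ∪ A₂.erase b',
        by grind, ?_, (k2.union l2 ?_).mono subset_rfl (by linarith)⟩, ?_, ?_⟩, ?_⟩)⟩
      · intro v hv
        have h3 := fun h => h₁.out v h a ha1
        have h4 := fun h => h₁.out v h b hb
        have h5 := fun h => h₂.out v h a ha
        have h6 := fun h => h₂.out v h b hb2
        grind
      · intro v hv w hw
        exact hsep v (by grind) w (by grind)
      · refine (k1.union l1 hsep).mono (by grind) (by linarith)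
      · refine (k1.union l1 hsep).mono (by grind) (by linarith)
      · rcases k3 with k3 | k3
        · rcases l3 with l3 | l3
          · rw [← Finset.disjoint_left] at hd
            exact Or.inl (extends_sides h₁ h₂ hb ha hd hB k3 l3)
          · right; linarith
        · right; linarith
    · have m3 := hB'.notMem₁
      have m4 := hB'.notMem₂
      have hcard := card_insert₂ hne m3 m4
      rcases ih B'.card (by lia) hB' (by lia) rfl with ⟨α, β, hα, hβ, h⟩ | h
      · rcases h with ⟨h1, h2⟩ | ⟨h1, h2⟩ | ⟨h1, h2⟩
        · exact Or.inl ⟨α, β, hα, hβ, Or.inr (Or.inl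
            ⟨(h1.step hB' hab).mono (by linarith) (by linarith)
              (le_max_of_le_right (by linarith)), h2.imp_left fun h => h _ _ hB⟩)⟩
        · exact Or.inl ⟨α, β, hα, hβ, Or.inr (Or.inr
            ⟨(h1.step hB' hab).mono (by linarith) (by linarith)
              (le_max_of_le_left (by linarith)), h2.imp_left fun h => h _ _ hB⟩)⟩
        · exact Or.inr (Or.inl ((h1.step hB' hab).mono (by linarith) (by linarith)
            (le_max_of_le_right (by linarith))))
      · right
        rcases h with h1 | h1 | h1
        · exact Or.inr (Or.inl ((h1.step hB' hab).mono (by linarith) (by linarith)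
            (le_max_of_le_right (by linarith))))
        · exact Or.inr (Or.inr ((h1.step hB' hab).mono (by linarith) (by linarith)
            (le_max_of_le_left (by linarith))))
        · exact Or.inl ((h1.step hB' hab).mono (by linarith) (by linarith)
            (le_max_of_le_right (by linarith)))

end LadderBounds

/-! ### The possible shapes of a branch at its root. -/

section BranchBounds

variable {V : Type*} {G : SimpleGraph V} [DecidableEq V]

/-- The totals `s` and `t` stand for `7 + α` and `-1 + β`. -/
lemma Bounds.of_strict {A : Finset V} {u : V} {s t : ℤ} (h₁ : Packs G A (5 * A.card + s))
    (h₂ : Packs G (A.erase u) (5 * A.card + t)) (hs : 7 ≤ s) (ht : -1 ≤ t)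
    (h : IsTreePart G A ∨ 7 < s ∨ -1 < t) : Bounds G A u := by
  refine ⟨s - 7, t + 1, by linarith, by linarith, h₁.mono subset_rfl (by linarith),
    h₂.mono subset_rfl (by linarith), ?_⟩
  rcases h with h | h | h
  · exact Or.inl h
  · right; linarith
  · right; linarith

/-- The root of the branch together with the first rung of a ladder forms a triangle. -/
lemma LadderBounds.bounds_insert {B : Finset V} {a b u : V} {p q r : ℤ}
    (h : LadderBounds G B a b p q r) (hB : RungEnd G B a b u u)
    (hr : 12 < r ∨ (-2 ≤ p ∧ 4 ≤ r ∧ (IsTreePart G (insert u B) ∨ -2 < p ∨ 4 < r))) :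
    Bounds G (insert u B) u := by
  obtain ⟨⟨Q, hQ, hQ', h1⟩, -, h3⟩ := h
  have hu := hB.notMem₁
  have hcard : ((insert u B).card : ℤ) = B.card + 1 := by
    rw [Finset.card_insert_of_notMem hu]; push_cast; ring
  have hall : Packs G ((insert u B).erase u) (5 * (insert u B).card + (r - 5)) :=
    h3.mono (by grind) (by linarith)
  -- Relative to the order of `insert u B`, ignoring `u` is worth `r - 5`, and the triangle `u a b`
  -- with a far set 24 - 10 - 5 + p = 9 + p. Both bounds are tight exactly for p = -2 and r = 4, the
  -- third state of the ladder.
  rcases hr with hr | ⟨hp, hr, h⟩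
  · exact Bounds.of_strict (hall.mono (by grind) le_rfl) hall (by linarith) (by linarith)
      (by right; left; linarith)
  · refine Bounds.of_strict (s := 9 + p) (((packs_triangle hB.adj hB.adj₁ hB.adj₂).union h1 ?_).mono
      ?_ (by linarith)) hall (by linarith) (by linarith) ?_
    · intro v hv w hw
      have hwB := hQ hw
      have h4 := hQ' w hw
      have h5 := fun h => hB.out w hwB u hu h
      have hsymm : ∀ x y, G.Adj x y → G.Adj y x := fun _ _ h => h.symm
      simp only [Finset.mem_insert, Finset.mem_singleton] at hv
      rcases hv with rfl | rfl | rfl <;> grind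
    · have := hB.mem₁
      have := hB.mem₂
      grind
    · rcases h with h | h | h
      · exact Or.inl h
      · right; left; linarith
      · right; right; linarith

/-- The root `u` lies in a rung `u b` at the start of a ladder, and `b` has a branch. -/
lemma LadderBounds.bounds_corner {A B : Finset V} {a x u b b' : V} {p q r : ℤ}
    (h : LadderBounds G B a x p q r) (hB : RungEnd G B a x u b) (hA : IsBranch G A b' b)
    (hAb : Bounds G A b') (hd : Disjoint A B) (hu : u ∉ A) (hub : G.Adj u b) (hux : ¬ G.Adj u x)
    (hab : ¬ G.Adj a b) (hr : 4 ≤ r) (hp : 10 ≤ r ∨ -4 ≤ p) :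
    Bounds G (insert u (insert b (A ∪ B))) u := by
  obtain ⟨⟨Q, hQ, hQ', h1⟩, -, h3⟩ := h
  obtain ⟨α, β, hα, hβ, k1, k2, -⟩ := hAb
  have huB := hB.notMem₁
  have hbB := hB.notMem₂
  have hbA := hA.notMem
  have hne := hub.ne
  have haB := hB.mem₁
  have hxB := hB.mem₂
  have hcard : ((insert u (insert b (A ∪ B))).card : ℤ) = A.card + B.card + 2 := by
    rw [card_insert₂ hne (by grind) (by grind), Finset.card_union_of_disjoint hd]
    push_cast; ring
  rw [Finset.disjoint_right] at hd
  have hsep : Sep G B A := hA.sep fun v hv => ⟨hd hv, by grind⟩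
  have hall : Packs G ((insert u (insert b (A ∪ B))).erase u)
      (5 * (insert u (insert b (A ∪ B))).card + (r - 3)) :=
    (h3.union k1 hsep).mono (by grind) (by linarith)
  -- Ignoring `u` and `b` is worth `r + 7 - 10`, which exceeds -1 and reaches 7 once `10 ≤ r`. For
  -- the unrestricted bound the alternative is the square on the two rungs with a far set and the
  -- branch without its root: 32 - 10 - 1 - 10 + p = 11 + p.
  rcases hp with hp | hp
  · exact Bounds.of_strict (hall.mono (by grind) le_rfl) hall (by linarith) (by linarith)
      (by right; right; linarith)
  · have hsq : Packs G {u, b, x, a} 32 := packs_square hub hB.adj₂.symm hB.adj.symm hB.adj₁ hux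
      (fun h => hab h.symm) (by grind) (by grind)
    refine Bounds.of_strict (s := 11 + p) (((hsq.union h1 ?_).union k2 (hA.sep_erase ?_)).mono ?_
      (by linarith)) hall (by linarith) (by linarith) (by right; right; linarith)
    · intro v hv w hw
      have hwB := hQ hw
      have h4 := hQ' w hw
      have h5 := fun h => hB.out w hwB u huB h
      have h6 := fun h => hB.out w hwB b hbB h
      have hsymm : ∀ x y, G.Adj x y → G.Adj y x := fun _ _ h => h.symm
      simp only [Finset.mem_insert, Finset.mem_singleton] at hv
      rcases hv with rfl | rfl | rfl | rfl <;> grind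
    · intro v hv
      simp only [Finset.mem_insert, Finset.mem_singleton, Finset.mem_union] at hv
      grind
    · grind

/-- Without its root, `A` is a ladder end whose two outer neighbours coincide with `u`. -/
lemma bounds_of_triangle [Fintype V] (hG : G.Connected) (hcub : Cubic G) (hch : IsKChordal 4 G)
    {A : Finset V} {u x₀ a b : V} (hA : IsBranch G A u x₀)
    (ih : ∀ A' u' x', IsBranch G A' u' x' → A'.card < A.card → Bounds G A' u')
    (hn : Nbrs G u x₀ a b) (hab : G.Adj a b) : Bounds G A u := by
  have hsymm : ∀ x y, G.Adj x y → G.Adj y x := fun _ _ h => h.symm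
  obtain ⟨k1, k2, k3, hu⟩ := hn
  obtain ⟨h1, h2, h3, h4⟩ := id hA
  have hua : G.Adj u a := (hu a).2 (by simp)
  have hub : G.Adj u b := (hu b).2 (by simp)
  have haA : a ∈ A := by
    by_contra h
    have := h4 u h1 a h hua
    grind
  have hbA : b ∈ A := by
    by_contra h
    have := h4 u h1 b h hub
    grind
  have hua' := hua.ne
  have hub' := hub.ne
  have hB : RungEnd G (A.erase u) a b u u := by
    refine ⟨by grind, by grind, by simp, by simp, hab, hua.symm, hub.symm, ?_⟩
    intro v hv w hw hvw
    have := h4 v (by grind) w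
    grind
  have hins : insert u (A.erase u) = A := Finset.insert_erase h1
  have hstate := hB.ladderState hG hcub hch ih (Finset.card_le_card (Finset.erase_subset _ _))
  rw [← hins]
  rcases hstate with ⟨α, β, hα, hβ, ⟨h, h'⟩ | ⟨h, h'⟩ | ⟨h, h'⟩⟩ | h | h | h
  · exact h.bounds_insert hB (Or.inr ⟨by linarith, by linarith, by right; left; linarith⟩)
  · exact h.bounds_insert hB (Or.inl (by linarith))
  · refine h.bounds_insert hB (Or.inr ⟨by linarith, by linarith, ?_⟩)
    rcases h' with h' | h'
    · exact Or.inl (h' rfl)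
    · by_cases h0 : 0 < β
      · right; left; linarith
      · right; right; linarith
  · exact h.bounds_insert hB (Or.inr ⟨by linarith, by linarith, by right; left; linarith⟩)
  · exact h.bounds_insert hB (Or.inl (by linarith))
  · exact h.bounds_insert hB (Or.inr ⟨by linarith, by linarith, by right; left; linarith⟩)

lemma LadderState.bounds_corner {A B : Finset V} {a x u b b' : V}
    (h : LadderState G B a x u b) (hB : RungEnd G B a x u b) (hA : IsBranch G A b' b)
    (hAb : Bounds G A b') (hd : Disjoint A B) (hu : u ∉ A) (hub : G.Adj u b) (hux : ¬ G.Adj u x)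
    (hab : ¬ G.Adj a b) : Bounds G (insert u (insert b (A ∪ B))) u := by
  rcases h with ⟨α, β, hα, hβ, ⟨h, h'⟩ | ⟨h, h'⟩ | ⟨h, h'⟩⟩ | h | h | h
  · exact h.bounds_corner hB hA hAb hd hu hub hux hab (by linarith) (Or.inr (by linarith))
  · exact h.bounds_corner hB hA hAb hd hu hub hux hab (by linarith) (Or.inl (by linarith))
  · exact h.bounds_corner hB hA hAb hd hu hub hux hab (by linarith) (Or.inr (by linarith))
  · exact h.bounds_corner hB hA hAb hd hu hub hux hab (by linarith) (Or.inr (by linarith))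
  · exact h.bounds_corner hB hA hAb hd hu hub hux hab (by linarith) (Or.inl (by linarith))
  · exact h.bounds_corner hB hA hAb hd hu hub hux hab (by linarith) (Or.inr (by linarith))

/-- The root of the branch is a cut vertex with two branches. -/
lemma bounds_of_no_common [Fintype V] (hG : G.Connected) (hcub : Cubic G) (hch : IsKChordal 4 G)
    {A : Finset V} {u x₀ a b : V} (hA : IsBranch G A u x₀)
    (ih : ∀ A' u' x', IsBranch G A' u' x' → A'.card < A.card → Bounds G A' u')
    (hn : Nbrs G u x₀ a b) (hab : ¬ G.Adj a b)
    (hcom : ∀ x, G.Adj x a → G.Adj x b → x = u) : Bounds G A u := by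
  have hsymm : ∀ x y, G.Adj x y → G.Adj y x := fun _ _ h => h.symm
  obtain ⟨k1, k2, k3, hu⟩ := hn
  obtain ⟨h1, h2, h3, h4⟩ := id hA
  have hua : G.Adj u a := (hu a).2 (by simp)
  have hub : G.Adj u b := (hu b).2 (by simp)
  have haA : a ∈ A := by
    by_contra h
    have := h4 u h1 a h hua
    grind
  have hbA : b ∈ A := by
    by_contra h
    have := h4 u h1 b h hub
    grind
  have hx0 : ∀ v ∈ A, G.Adj v x₀ → v = u := fun v hv h => (h4 v hv x₀ h2 h).1
  have hne := hua.ne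
  have hne' := hub.ne
  have key : ∀ a b, G.Adj u a → a ∈ A → b ∈ A → ¬ G.Adj a b →
      (∀ w, G.Adj u w ↔ w = x₀ ∨ w = a ∨ w = b) → u ≠ a →
      (∀ x, G.Adj x a → G.Adj x b → x = u) → ∃ A, IsBranch G A a u := by
    intro a b hua haA hbA hab hu hne hcom
    rcases edge_cases hcub hch hua.symm with h | ⟨w, h5, h6⟩ | ⟨p, q, h5, h6, h7, h8, h9⟩
    · exact h
    · exfalso
      have hirr : ∀ x, ¬ G.Adj x x := fun _ => G.irrefl
      have := hx0 a haA
      grind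
    · exfalso
      have hq : q = x₀ ∨ q = b := by grind
      rcases hq with rfl | rfl
      · have := hx0 p
        have := h4 a haA p
        grind
      · exact h8 (hcom p h7 h6.symm)
  obtain ⟨A₁, hA₁⟩ := key a b hua haA hbA hab hu hne hcom
  obtain ⟨A₂, hA₂⟩ := key b a hub hbA haA (fun h => hab h.symm) (by grind) hne' fun x h h' =>
    hcom x h' h
  have hu1 := hA₁.notMem
  have hu2 := hA₂.notMem
  have hd := hA₁.disjoint hG hA₂ hu2 hu1 (Or.inl k3)
  have hx1 : x₀ ∉ A₁ := hA₁.notMem_of_adj hu1 h3 (by grind)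
  have hx2 : x₀ ∉ A₂ := hA₂.notMem_of_adj hu2 h3 (by grind)
  have heq : A = insert u (A₁ ∪ A₂) := by
    refine hA.unique hG ⟨by simp, by grind, h3, ?_⟩
    intro v hv w hw hvw
    have := hA₁.out v
    have := hA₂.out v
    have := hA₁.mem
    have := hA₂.mem
    simp only [Finset.mem_insert, Finset.mem_union, not_or] at hv hw
    rcases hv with rfl | hv | hv <;> grind
  have hcard : (A.card : ℤ) = A₁.card + A₂.card + 1 := by
    rw [heq, Finset.card_insert_of_notMem (by grind), Finset.card_union_of_disjoint hd]
    push_cast; ring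
  obtain ⟨α₁, β₁, hα₁, hβ₁, p1, -, -⟩ := ih A₁ _ _ hA₁ (by lia)
  obtain ⟨α₂, β₂, hα₂, hβ₂, p2, -, -⟩ := ih A₂ _ _ hA₂ (by lia)
  rw [Finset.disjoint_left] at hd
  have hsep : Sep G A₁ A₂ := hA₂.sep fun v hv => ⟨hd hv, by grind⟩
  -- Each branch gains 7 and the omitted root costs 5.
  have hall : Packs G (A.erase u) (5 * A.card + 9) :=
    (p1.union p2 hsep).mono (by grind) (by linarith)
  exact Bounds.of_strict (hall.mono (by grind) le_rfl) hall (by norm_num) (by norm_num)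
    (by norm_num)

set_option maxHeartbeats 1000000 in
/-- The two neighbours of the root in the branch have two further common neighbours. -/
lemma bounds_of_two_three [Fintype V] (hG : G.Connected) (hcub : Cubic G) (hch : IsKChordal 4 G)
    {A : Finset V} {u x₀ a b x y : V} (hA : IsBranch G A u x₀)
    (ih : ∀ A' u' x', IsBranch G A' u' x' → A'.card < A.card → Bounds G A' u')
    (hn : Nbrs G u x₀ a b) (hna : Nbrs G a u x y) (hnb : Nbrs G b u x y) : Bounds G A u := by
  have hsymm : ∀ x y, G.Adj x y → G.Adj y x := fun _ _ h => h.symm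
  have hirr : ∀ x, ¬ G.Adj x x := fun _ => G.irrefl
  obtain ⟨k1, k2, k3, hu⟩ := hn
  have l1 := hna.ne₁
  have l2 := hna.ne₂
  have l3 := hna.ne₃
  have na := hna.adj
  have nb := hnb.adj
  obtain ⟨h1, h2, h3, h4⟩ := id hA
  have hua : G.Adj u a := (hu a).2 (by simp)
  have hub : G.Adj u b := (hu b).2 (by simp)
  have hxa : G.Adj x a := ((na x).2 (by simp)).symm
  have hxb : G.Adj x b := ((nb x).2 (by simp)).symm
  have hya : G.Adj y a := ((na y).2 (by simp)).symm
  have hyb : G.Adj y b := ((nb y).2 (by simp)).symm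
  have haA : a ∈ A := by
    by_contra h
    have := h4 u h1 a h hua
    grind
  have hxA : x ∈ A := by
    by_contra h
    have := h4 a haA x h hxa.symm
    grind
  have hyA : y ∈ A := by
    by_contra h
    have := h4 a haA y h hya.symm
    grind
  have hx0 : ∀ v ∈ A, G.Adj v x₀ → v = u := fun v hv h => (h4 v hv x₀ h2 h).1
  have hux : ¬ G.Adj u x := by have := hx0 a haA; grind
  have huy : ¬ G.Adj u y := by have := hx0 a haA; grind
  have hab : ¬ G.Adj a b := by grind
  have n1 : u ≠ a := hua.ne
  have n2 : u ≠ b := hub.ne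
  have n3 : x ≠ a := hxa.ne
  have n4 : x ≠ b := hxb.ne
  have n5 : y ≠ a := hya.ne
  have n6 : y ≠ b := hyb.ne
  have hx0x : x ≠ x₀ := by grind
  have hx0y : y ≠ x₀ := by grind
  have hsq : Packs G {u, a, x, b} 32 :=
    packs_square hua hxa.symm hxb hub.symm hux hab l1 k3
  by_cases hxy : G.Adj x y
  · have heq : A = {u, a, b, x, y} := by
      have nx : ∀ w, G.Adj x w ↔ w = a ∨ w = b ∨ w = y := by
        obtain ⟨z, _, _, _, h⟩ := hcub.third hxa hxb k3
        grind
      have ny : ∀ w, G.Adj y w ↔ w = a ∨ w = b ∨ w = x := by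
        obtain ⟨z, _, _, _, h⟩ := hcub.third hya hyb k3
        grind
      refine hA.unique hG ⟨by simp, by grind, h3, ?_⟩
      intro v hv w hw hvw
      simp only [Finset.mem_insert, Finset.mem_singleton, not_or] at hv hw
      rcases hv with rfl | rfl | rfl | rfl | rfl <;> grind
    have hcard : (A.card : ℤ) = 5 := by
      rw [heq, card_insert₂ n1 (by grind) (by grind), card_insert₂ (by grind) (by grind) (by grind)]
      simp
    -- This is the piece `D'`, tight for both bounds: the square through `u` gives 32 = 25 + 7 and
    -- the triangle avoiding `u` gives 24 = 25 - 1.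
    refine Bounds.of_strict (s := 7) (t := -1) (hsq.mono (by grind) (by linarith))
      ((packs_triangle hxa.symm hya.symm hxy).mono (by grind) (by linarith)) (by norm_num)
      (by norm_num) (Or.inl ?_)
    apply IsPiece.isTreePart
    rw [heq]
    simpa using isPiece_diamond' ⟨hux, huy⟩ hna hnb k3 hxy
  · obtain ⟨x', m1, m2, m3, nx⟩ := hcub.third hxa hxb k3
    obtain ⟨y', m4, m5, m6, ny⟩ := hcub.third hya hyb k3
    have hxx : G.Adj x x' := (nx x').2 (by simp)
    have hyy : G.Adj y y' := (ny y').2 (by simp)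
    have hsq' : Packs G {a, x, b, y} 32 :=
      packs_square hxa.symm hxb hyb.symm hya hab hxy k3 l3
    by_cases hxy' : x' = y'
    · subst hxy'
      obtain ⟨z, q1, q2, q3, nz⟩ := hcub.third hxx.symm hyy.symm l3
      have hzz : G.Adj x' z := (nz z).2 (by simp)
      have hBr : ∃ A', IsBranch G A' z x' := by
        rcases edge_cases hcub hch hzz.symm with h | ⟨w, h5, h6⟩ | ⟨p, q, h5, h6, h7, h8, h9⟩
        · exact h
        · grind
        · exfalso
          have hq : q = x ∨ q = y := by grind
          have hp : p = a ∨ p = b := by rcases hq with rfl | rfl <;> grind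
          have hz : z = u := by rcases hp with rfl | rfl <;> grind
          subst hz
          have := hx0 x hxA
          grind
      obtain ⟨A', hA'⟩ := hBr
      have hz := hA'.mem
      have c1 := hA'.notMem
      have c2 : x ∉ A' := hA'.notMem_of_adj c1 hxx.symm (by grind)
      have c3 : y ∉ A' := hA'.notMem_of_adj c1 hyy.symm (by grind)
      have hx'A : x' ∈ A := by
        by_contra h
        have := h4 x hxA x' h hxx
        grind
      have hx'u : x' ≠ u := by grind
      have hx'a : x' ≠ a := by grind
      have hx'b : x' ≠ b := by grind
      have c4 : a ∉ A' := hA'.notMem_of_adj c2 hxa (by grind)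
      have c5 : b ∉ A' := hA'.notMem_of_adj c2 hxb (by grind)
      have c6 : u ∉ A' := hA'.notMem_of_adj c4 hua.symm (by grind)
      have c7 : x₀ ∉ A' := hA'.notMem_of_adj c6 h3 (by grind)
      have heq : A = insert u (insert a (insert b (insert x (insert y (insert x' A'))))) := by
        refine hA.unique hG ⟨by simp, by grind, h3, ?_⟩
        intro v hv w hw hvw
        have h5 := hA'.out v
        clear h4 ih
        simp only [Finset.mem_insert, not_or] at hv hw
        rcases hv with rfl | rfl | rfl | rfl | rfl | rfl | hv <;> grind
      have hcard : (A.card : ℤ) = A'.card + 6 := by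
        rw [heq, card_insert₂ n1 (by grind) (by grind), card_insert₂ (by grind) (by grind) (by grind),
          card_insert₂ (by grind) (by grind) (by grind)]
        ring
      obtain ⟨α, β, hα, hβ, p1, -, -⟩ := ih A' _ _ hA' (by lia)
      -- The square `a x b y` misses both `u` and `x'`, so `A'` may be used freely: 32 + 7 - 30 = 9.
      have hall : Packs G (A.erase u) (5 * A.card + 9) := by
        refine (hsq'.union p1 (hA'.sep ?_)).mono (by grind) (by linarith)
        intro v hv
        simp only [Finset.mem_insert, Finset.mem_singleton] at hv
        grind
      exact Bounds.of_strict (hall.mono (by grind) le_rfl) hall (by norm_num) (by norm_num)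
        (by norm_num)
    · have key : ∀ x y x', G.Adj x x' → (∀ w, G.Adj x w ↔ w = a ∨ w = b ∨ w = x') → x' ≠ a → x' ≠ b →
          x' ≠ y → x' ≠ u → ¬ G.Adj y x' → ¬ G.Adj u x' → (∀ w, G.Adj a w ↔ w = u ∨ w = x ∨ w = y) →
          (∀ w, G.Adj b w ↔ w = u ∨ w = x ∨ w = y) → ∃ A', IsBranch G A' x' x := by
        intro x y x' hxx nx e1 e2 e3 e4 e5 e6 na nb
        rcases edge_cases hcub hch hxx.symm with h | ⟨w, h5, h6⟩ | ⟨p, q, h5, h6, h7, h8, h9⟩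
        · exact h
        · grind
        · exfalso
          have hq : q = a ∨ q = b := by grind
          have hp : p = u ∨ p = y := by rcases hq with rfl | rfl <;> grind
          rcases hp with rfl | rfl <;> grind
      have hx'A : x' ∈ A := by
        by_contra h
        have := h4 x hxA x' h hxx
        grind
      have hy'A : y' ∈ A := by
        by_contra h
        have := h4 y hyA y' h hyy
        grind
      have ex : x' ≠ u := by grind
      have ey : y' ≠ u := by grind
      have exy : x' ≠ y := by grind
      have eyx : y' ≠ x := by grind
      obtain ⟨A₁, hA₁⟩ := key x y x' hxx nx (by grind) (by grind) exy ex (by grind) (by grind) na nb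
      obtain ⟨A₂, hA₂⟩ := key y x y' hyy ny (by grind) (by grind) eyx ey (by grind) (by grind)
        (by grind) (by grind)
      have c1 := hA₁.notMem
      have c2 : a ∉ A₁ := hA₁.notMem_of_adj c1 hxa (by grind)
      have c3 : b ∉ A₁ := hA₁.notMem_of_adj c1 hxb (by grind)
      have c4 : y ∉ A₁ := hA₁.notMem_of_adj c2 hya.symm (by grind)
      have c5 : u ∉ A₁ := hA₁.notMem_of_adj c2 hua.symm (by grind)
      have c6 : x₀ ∉ A₁ := hA₁.notMem_of_adj c5 h3 (by grind)
      have d1 := hA₂.notMem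
      have d2 : a ∉ A₂ := hA₂.notMem_of_adj d1 hya (by grind)
      have d3 : b ∉ A₂ := hA₂.notMem_of_adj d1 hyb (by grind)
      have d4 : x ∉ A₂ := hA₂.notMem_of_adj d2 hxa.symm (by grind)
      have d5 : u ∉ A₂ := hA₂.notMem_of_adj d2 hua.symm (by grind)
      have d6 : x₀ ∉ A₂ := hA₂.notMem_of_adj d5 h3 (by grind)
      have hd := hA₁.disjoint hG hA₂ d4 c4 (Or.inl hxy')
      have f1 := hA₁.mem
      have f2 := hA₂.mem
      have heq : A = insert u (insert a (insert b (insert x (insert y (A₁ ∪ A₂))))) := by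
        refine hA.unique hG ⟨by simp, by grind, h3, ?_⟩
        intro v hv w hw hvw
        have h5 := hA₁.out v
        have h6 := hA₂.out v
        clear h4 ih key
        simp only [Finset.mem_insert, Finset.mem_union, not_or] at hv hw
        rcases hv with rfl | rfl | rfl | rfl | rfl | hv | hv <;> grind
      have hcard : (A.card : ℤ) = A₁.card + A₂.card + 5 := by
        rw [heq, card_insert₂ n1 (by grind) (by grind), card_insert₂ (by grind) (by grind) (by grind),
          Finset.card_insert_of_notMem (by grind), Finset.card_union_of_disjoint hd]
        push_cast; ring
      obtain ⟨α₁, β₁, hα₁, hβ₁, p1, q1, -⟩ := ih A₁ _ _ hA₁ (by lia)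
      obtain ⟨α₂, β₂, hα₂, hβ₂, p2, q2, -⟩ := ih A₂ _ _ hA₂ (by lia)
      rw [Finset.disjoint_left] at hd
      -- The square `u a x b` misses `y`, so only `A₁` loses its root: 32 - 1 + 7 - 25 = 13. The
      -- square `a x b y` avoids `u` but touches both branches: 32 - 1 - 1 - 25 = 5.
      refine Bounds.of_strict (s := 13) (t := 5) (((hsq.union q1 (hA₁.sep_erase ?_)).union p2
        (hA₂.sep ?_)).mono ?_ (by linarith)) (((hsq'.union q1 (hA₁.sep_erase ?_)).union q2
        (hA₂.sep_erase ?_)).mono ?_ (by linarith)) (by norm_num) (by norm_num) (by norm_num)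
      · intro v hv
        simp only [Finset.mem_insert, Finset.mem_singleton] at hv
        rcases hv with rfl | rfl | rfl | rfl
        exacts [c5, c2, c1, c3]
      · intro v hv
        simp only [Finset.mem_insert, Finset.mem_singleton, Finset.mem_union, Finset.mem_erase] at hv
        rcases hv with (rfl | rfl | rfl | rfl) | ⟨-, hv⟩
        exacts [⟨d5, l2⟩, ⟨d2, n5.symm⟩, ⟨d4, l3⟩, ⟨d3, n6.symm⟩, ⟨hd hv, fun h => c4 (h ▸ hv)⟩]
      · clear ih h4 na nb nx ny hu hna hnb hx0 key
        grind
      · intro v hv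
        simp only [Finset.mem_insert, Finset.mem_singleton] at hv
        rcases hv with rfl | rfl | rfl | rfl
        exacts [c2, c1, c3, c4]
      · intro v hv
        simp only [Finset.mem_insert, Finset.mem_singleton, Finset.mem_union, Finset.mem_erase] at hv
        rcases hv with (rfl | rfl | rfl | rfl) | ⟨-, hv⟩
        exacts [d2, d4, d3, d1, hd hv]
      · clear ih h4 na nb nx ny hu hna hnb hx0 key
        grind

end BranchBounds

/-! ### The induction over branches and the lower bound. -/

section LowerBound

variable {V : Type*} {G : SimpleGraph V} [Fintype V]

/-- Deleting `u`, `b` and the branch at `b` leaves a ladder end with first rung `a x`, so `u b` is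
the corner rung of `LadderState.bounds_corner`. -/
lemma bounds_of_isBranch_second [DecidableEq V] (hG : G.Connected) (hcub : Cubic G)
    (hch : IsKChordal 4 G) {A A₂ : Finset V} {u x₀ a b x a' b' : V} (hA : IsBranch G A u x₀)
    (ih : ∀ A' u' x', IsBranch G A' u' x' → A'.card < A.card → Bounds G A' u')
    (hn : Nbrs G u x₀ a b) (hab : ¬ G.Adj a b) (hna : Nbrs G a u x a') (hnb : Nbrs G b u x b')
    (hA₂ : IsBranch G A₂ b' b) : Bounds G A u := by
  have hsymm : ∀ x y, G.Adj x y → G.Adj y x := fun _ _ h => h.symm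
  have hirr : ∀ x, ¬ G.Adj x x := fun _ => G.irrefl
  obtain ⟨k1, k2, k3, hu⟩ := hn
  obtain ⟨l1, l2, l3, na⟩ := hna
  obtain ⟨-, m2, m3, nb⟩ := hnb
  obtain ⟨h1, h2, h3, h4⟩ := id hA
  have hua : G.Adj u a := (hu a).2 (by simp)
  have hub : G.Adj u b := (hu b).2 (by simp)
  have hax : G.Adj a x := (na x).2 (by simp)
  have hbx : G.Adj b x := (nb x).2 (by simp)
  have hbb : G.Adj b b' := (nb b').2 (by simp)
  have hne := hub.ne
  have haA : a ∈ A := by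
    by_contra h
    have := h4 u h1 a h hua
    grind
  have hbA : b ∈ A := by
    by_contra h
    have := h4 u h1 b h hub
    grind
  have hx0 : ∀ v ∈ A, G.Adj v x₀ → v = u := fun v hv h => (h4 v hv x₀ h2 h).1
  have hxA : x ∈ A := by
    by_contra h
    have := h4 a haA x h hax
    grind
  have hbA' : b' ∈ A := by
    by_contra h
    have := h4 b hbA b' h hbb
    grind
  have hux : ¬ G.Adj u x := by have := hx0 a haA; grind
  have hbA₂ := hA₂.notMem
  have huA₂ : u ∉ A₂ := hA₂.notMem_of_adj hbA₂ hub.symm (by grind)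
  have haA₂ : a ∉ A₂ := hA₂.notMem_of_adj huA₂ hua (by grind)
  have hxA₂ : x ∉ A₂ := hA₂.notMem_of_adj hbA₂ hbx (by grind)
  have hsub : A₂ ⊆ A := hA.subset hG hA₂ hbA' huA₂
  have hout := hA₂.out
  have hbA₂' := hA₂.mem
  have hB : RungEnd G (((A.erase u).erase b) \ A₂) a x u b := by
    refine ⟨by grind, by grind, by grind, by grind, hax, hua.symm, hbx.symm, ?_⟩
    intro v hv w hw hvw
    simp only [Finset.mem_sdiff, Finset.mem_erase, not_and, not_not] at hv hw
    obtain ⟨⟨v1, v2, v3⟩, v4⟩ := hv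
    by_cases e1 : w = u
    · subst e1
      have := hx0 v v3
      grind
    by_cases e2 : w = b
    · subst e2
      have := (nb v).1 hvw.symm
      grind
    by_cases e3 : w ∈ A
    · have := hout w (hw ⟨e2, e1, e3⟩) v v4 hvw.symm
      grind
    · have := h4 v v3 w e3 hvw
      grind
  have heq : A = insert u (insert b (A₂ ∪ ((A.erase u).erase b \ A₂))) := by
    ext v
    have := @hsub v
    simp only [Finset.mem_insert, Finset.mem_union, Finset.mem_sdiff, Finset.mem_erase]
    by_cases e1 : v = u
    · simp [e1, h1]
    by_cases e2 : v = b
    · simp [e2, hbA]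
    tauto
  rw [heq]
  have hlt : A₂.card < A.card :=
    Finset.card_lt_card ((Finset.ssubset_iff_of_subset hsub).2 ⟨u, h1, huA₂⟩)
  exact (hB.ladderState hG hcub hch ih (Finset.card_le_card (by grind))).bounds_corner hB hA₂
    (ih _ _ _ hA₂ hlt) Finset.disjoint_sdiff huA₂ hub hux hab

/-- The edge `b b'` lies in a triangle, which is `b b' x` and means `b' = x'`, or in a 4-cycle,
which is `b b' x' x`; such cycles cannot pass through `u`. -/
lemma outer_neighbour_of_not_branch [DecidableEq V] (hcub : Cubic G)
    (hch : IsKChordal 4 G) {A : Finset V} {u x₀ a b x a' b' x' : V} (hA : IsBranch G A u x₀)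
    (hn : Nbrs G u x₀ a b) (hab : ¬ G.Adj a b) (hna : Nbrs G a u x a') (hnb : Nbrs G b u x b')
    (hnx : Nbrs G x a b x') (hab' : a' ≠ b') (h : ¬ ∃ A₂, IsBranch G A₂ b' b) :
    b' = x' ∨ G.Adj b' x' := by
  have hsymm : ∀ x y, G.Adj x y → G.Adj y x := fun _ _ h => h.symm
  have hirr : ∀ x, ¬ G.Adj x x := fun _ => G.irrefl
  obtain ⟨k1, k2, k3, hu⟩ := hn
  obtain ⟨l1, l2, l3, na⟩ := hna
  obtain ⟨-, m2, m3, nb⟩ := hnb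
  obtain ⟨-, -, -, nx⟩ := hnx
  obtain ⟨h1, h2, h3, h4⟩ := id hA
  have hub : G.Adj u b := (hu b).2 (by simp)
  have hbb : G.Adj b b' := (nb b').2 (by simp)
  have hbA : b ∈ A := by
    by_contra h
    have := h4 u h1 b h hub
    grind
  have hne := hub.ne
  have hx0 : ∀ v ∈ A, G.Adj v x₀ → v = u := fun v hv h => (h4 v hv x₀ h2 h).1
  have hbA' : b' ∈ A := by
    by_contra h
    have := h4 b hbA b' h hbb
    grind
  have hub' : ¬ G.Adj u b' := by
    have := hx0 b hbA
    grind
  rcases edge_cases hcub hch hbb.symm with h' | ⟨w, h5, h6⟩ | ⟨p, q, h5, h6, h7, h8, h9⟩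
  · exact absurd h' h
  · grind
  · have hq : q = u ∨ q = x := by grind
    rcases hq with rfl | rfl
    · have hp : p = x₀ ∨ p = a := by grind
      rcases hp with rfl | rfl
      · have := hx0 b' hbA' h7.symm
        grind
      · grind
    · have hp : p = a ∨ p = x' := by grind
      rcases hp with rfl | rfl
      · grind
      · exact Or.inr h7.symm

/-- If neither edge is a bridge, `a'` and `b'` each equal `x'` or are adjacent to it. Then `u a a'
b' b` or `u a a' x' b' b` is a hole. -/
lemma exists_isBranch_or [DecidableEq V] (hcub : Cubic G)
    (hch : IsKChordal 4 G) {A : Finset V} {u x₀ a b x a' b' : V} (hA : IsBranch G A u x₀)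
    (hn : Nbrs G u x₀ a b) (hab : ¬ G.Adj a b) (hna : Nbrs G a u x a') (hnb : Nbrs G b u x b')
    (hab' : a' ≠ b') : (∃ A₂, IsBranch G A₂ a' a) ∨ ∃ A₂, IsBranch G A₂ b' b := by
  by_contra! hcon
  have hxa : G.Adj x a := ((hna.adj x).2 (by simp)).symm
  have hxb : G.Adj x b := ((hnb.adj x).2 (by simp)).symm
  obtain ⟨x', hnx⟩ := hcub.third hxa hxb hn.ne₃
  have hn' : Nbrs G u x₀ b a := ⟨hn.ne₂, hn.ne₁, hn.ne₃.symm, fun w => by rw [hn.adj]; tauto⟩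
  have hnx' : Nbrs G x b a x' :=
    ⟨hnx.ne₁.symm, hnx.ne₃, hnx.ne₂, fun w => by rw [hnx.adj]; tauto⟩
  have e1 := outer_neighbour_of_not_branch hcub hch hA hn hab hna hnb hnx hab' (by simpa using hcon.2)
  have e2 := outer_neighbour_of_not_branch hcub hch hA hn' (fun h => hab h.symm) hnb hna hnx'
    hab'.symm (by simpa using hcon.1)
  have hsymm : ∀ x y, G.Adj x y → G.Adj y x := fun _ _ h => h.symm
  have hirr : ∀ x, ¬ G.Adj x x := fun _ => G.irrefl
  clear hn' hnx'
  obtain ⟨k1, k2, k3, hu⟩ := hn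
  obtain ⟨l1, l2, l3, na⟩ := hna
  obtain ⟨-, m2, m3, nb⟩ := hnb
  obtain ⟨-, -, -, nx⟩ := hnx
  obtain ⟨h1, h2, h3, h4⟩ := id hA
  have hx0 : ∀ v ∈ A, G.Adj v x₀ → v = u := fun v hv h => (h4 v hv x₀ h2 h).1
  have hua : G.Adj u a := (hu a).2 (by simp)
  have hub : G.Adj u b := (hu b).2 (by simp)
  have haa : G.Adj a a' := (na a').2 (by simp)
  have hbb : G.Adj b b' := (nb b').2 (by simp)
  have n1 := hua.ne
  have n2 := hub.ne
  have haA : a ∈ A := by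
    by_contra h
    have := h4 u h1 a h hua
    grind
  have hbA : b ∈ A := by
    by_contra h
    have := h4 u h1 b h hub
    grind
  have hxA : x ∈ A := by
    by_contra h
    have := h4 a haA x h hxa.symm
    grind
  have f1 : ¬ G.Adj u a' := by have := hx0 a haA; grind
  have f2 : ¬ G.Adj u b' := by have := hx0 b hbA; grind
  have f3 : ¬ G.Adj u x' := by have := hx0 x hxA; grind
  have f4 : ¬ G.Adj a b' := by grind
  have f5 : ¬ G.Adj a' b := by grind
  by_cases hadj : G.Adj a' b'
  · exact hch.no_five_cycle hua haa hadj hbb.symm hub.symm f1 f2 f4 hab f5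
  · have g1 : G.Adj b' x' := by grind
    have g2 : G.Adj a' x' := by grind
    exact hch.no_six_cycle hua haa g2 g1.symm hbb.symm hub.symm f1 f3 f2 (by grind) f4 hab hadj f5
      (by grind)

/-- The lower bounds hold for every branch of a connected cubic `4`-chordal graph. -/
lemma IsBranch.bounds [DecidableEq V] (hG : G.Connected) (hcub : Cubic G) (hch : IsKChordal 4 G)
    {A : Finset V} {u x₀ : V} (hA : IsBranch G A u x₀) : Bounds G A u := by
  induction hn : A.card using Nat.strong_induction_on generalizing A u x₀ with
  | _ n ih =>
    have ih' : ∀ A' u' x', IsBranch G A' u' x' → A'.card < A.card → Bounds G A' u' :=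
      fun A' u' x' h h' => ih _ (by omega) h rfl
    obtain ⟨a, b, hnu⟩ := hcub.others hA.adj
    by_cases hab : G.Adj a b
    · exact bounds_of_triangle hG hcub hch hA ih' hnu hab
    by_cases hcom : ∀ x, G.Adj x a → G.Adj x b → x = u
    · exact bounds_of_no_common hG hcub hch hA ih' hnu hab hcom
    push Not at hcom
    obtain ⟨x, hxa, hxb, hxu⟩ := hcom
    have hua : G.Adj u a := (hnu.adj a).2 (by simp)
    have hub : G.Adj u b := (hnu.adj b).2 (by simp)
    obtain ⟨a', hna⟩ := hcub.third hua.symm hxa.symm hxu.symm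
    obtain ⟨b', hnb⟩ := hcub.third hub.symm hxb.symm hxu.symm
    by_cases hab' : a' = b'
    · subst hab'
      exact bounds_of_two_three hG hcub hch hA ih' hnu hna hnb
    rcases exists_isBranch_or hcub hch hA hnu hab hna hnb hab' with ⟨A₂, h₂⟩ | ⟨A₂, h₂⟩
    · have hnu' : Nbrs G u x₀ b a :=
        ⟨hnu.ne₂, hnu.ne₁, hnu.ne₃.symm, fun w => by rw [hnu.adj]; tauto⟩
      exact bounds_of_isBranch_second hG hcub hch hA ih' hnu' (fun h => hab h.symm) hnb hna h₂
    · exact bounds_of_isBranch_second hG hcub hch hA ih' hnu hab hna hnb h₂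

lemma IsBranch.compl [DecidableEq V] {A : Finset V} {u x : V} (hA : IsBranch G A u x) :
    IsBranch G Aᶜ x u := by
  refine ⟨by simpa using hA.notMem, by simpa using hA.mem, hA.adj.symm, ?_⟩
  intro v hv w hw hvw
  simp only [Finset.mem_compl, not_not] at hv hw
  have := hA.out w hw v hv hvw.symm
  tauto

/-- The lower bound, which is attained only if `G` arises from a tree with a bridge. -/
lemma exists_twoReg [DecidableEq V] (hG : G.Connected) (hcub : Cubic G) (hch : IsKChordal 4 G)
    (hK4 : IsEmpty (G ≃g K 4)) (hK33 : IsEmpty (G ≃g K33)) (hprism : IsEmpty (G ≃g prism)) :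
    ∃ S : Finset V, TwoReg G S ∧ 5 * (Fintype.card V : ℤ) + 6 ≤ 8 * S.card ∧
      (5 * (Fintype.card V : ℤ) + 6 < 8 * S.card ∨
        ∃ A u x, IsBranch G A u x ∧ IsTreePart G A ∧ IsTreePart G Aᶜ) := by
  obtain ⟨A, u, x, hA⟩ := exists_isBranch_of_not_special hG hcub hch hK4 hK33 hprism
  obtain ⟨α, β, hα, hβ, p, q, h⟩ := hA.bounds hG hcub hch
  obtain ⟨α', β', hα', hβ', p', q', h'⟩ := hA.compl.bounds hG hcub hch
  have hcard : (A.card : ℤ) + Aᶜ.card = Fintype.card V := by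
    exact_mod_cast Finset.card_add_card_compl A
  -- A free choice on one side and a choice without the root on the other: 7 - 1 = 6.
  obtain ⟨S, -, hS, hS'⟩ := p.union q' (hA.compl.sep_erase (by simp))
  obtain ⟨T, -, hT, hT'⟩ := p'.union q (hA.sep_erase (by simp))
  by_cases hpos : 0 < α + β'
  · exact ⟨S, hS, by linarith, Or.inl (by linarith)⟩
  by_cases hpos' : 0 < α' + β
  · exact ⟨T, hT, by linarith, Or.inl (by linarith)⟩
  -- All four excesses vanish, so neither side has slack and both arise from trees.
  exact ⟨S, hS, by linarith, Or.inr ⟨A, u, x, hA, h.resolve_right (by linarith),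
    h'.resolve_right (by linarith)⟩⟩

lemma twoReg_iff {S : Finset V} : InducesTwoRegular G S ↔ TwoReg G S := by
  classical
  have key : ∀ v : (S : Set V), (G.induce (S : Set V)).degree v =
      (S.filter fun w => G.Adj v w).card := by
    intro v
    rw [← card_neighborFinset_eq_degree]
    refine Finset.card_bij (fun w _ => w.1) ?_ ?_ ?_
    · intro w hw
      rw [mem_neighborFinset] at hw
      exact Finset.mem_filter.2 ⟨w.2, hw⟩
    · intro w _ w' _ h
      exact Subtype.ext h
    · intro w hw
      rw [Finset.mem_filter] at hw
      exact ⟨⟨w, hw.1⟩, by rw [mem_neighborFinset]; exact hw.2, rfl⟩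
  have key' : ∀ v, (S.filter fun w => G.Adj v w).card = 2 ↔
      ∃ x ∈ S, ∃ y ∈ S, x ≠ y ∧ G.Adj v x ∧ G.Adj v y ∧ ∀ z ∈ S, G.Adj v z → z = x ∨ z = y := by
    intro v
    rw [Finset.card_eq_two]
    constructor
    · rintro ⟨x, y, hxy, h⟩
      have hx : x ∈ S.filter fun w => G.Adj v w := by rw [h]; simp
      have hy : y ∈ S.filter fun w => G.Adj v w := by rw [h]; simp
      rw [Finset.mem_filter] at hx hy
      refine ⟨x, hx.1, y, hy.1, hxy, hx.2, hy.2, fun z hz hvz => ?_⟩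
      have : z ∈ S.filter fun w => G.Adj v w := Finset.mem_filter.2 ⟨hz, hvz⟩
      rw [h] at this
      simpa using this
    · rintro ⟨x, hx, y, hy, hxy, h1, h2, h3⟩
      refine ⟨x, y, hxy, ?_⟩
      ext z
      simp only [Finset.mem_filter, Finset.mem_insert, Finset.mem_singleton]
      constructor
      · rintro ⟨h4, h5⟩
        exact h3 z h4 h5
      · rintro (rfl | rfl)
        · exact ⟨hx, h1⟩
        · exact ⟨hy, h2⟩
  constructor
  · intro h v hv
    rw [← key', ← key ⟨v, hv⟩]
    convert h ⟨v, hv⟩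
  · intro h v
    have := (key' v.1).2 (h v.1 v.2)
    rw [← key v] at this
    convert this

lemma TwoReg.card_le_cInd {S : Finset V} (h : TwoReg G S) : S.card ≤ cInd G := by
  classical
  unfold cInd
  refine Finset.le_sup (f := Finset.card) ?_
  rw [Finset.mem_filter]
  exact ⟨Finset.mem_univ _, twoReg_iff.2 h⟩

lemma exists_card_eq_cInd (G : SimpleGraph V) : ∃ S : Finset V, TwoReg G S ∧ S.card = cInd G := by
  classical
  have hne : (Finset.univ.filter fun S : Finset V => InducesTwoRegular G S).Nonempty :=
    ⟨∅, by
      rw [Finset.mem_filter, twoReg_iff]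
      exact ⟨Finset.mem_univ _, fun v hv => absurd hv (by simp)⟩⟩
  obtain ⟨S, hS, hS'⟩ := Finset.exists_mem_eq_sup _ hne Finset.card
  rw [Finset.mem_filter, twoReg_iff] at hS
  refine ⟨S, hS.2, ?_⟩
  rw [← hS']
  unfold cInd
  congr!

end LowerBound

/-! ### The upper bound for graphs arising from trees, and the tree in the case of equality. -/

section Counting

variable {V : Type*} {G : SimpleGraph V}

/-- The number of neighbours that the vertex `i` of a piece of a cubic graph has outside the piece. -/
def slack {n : ℕ} (M : Fin n → Fin n → Bool) (i : Fin n) : ℕ :=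
  3 - (Finset.univ.filter fun j => M i j = true).card

/-- The counting inequality between a `2`-regular subgraph and the degree-`2` vertices of a piece. -/
def PieceInequality {n : ℕ} (M : Fin n → Fin n → Bool) : Prop :=
  ∀ s : Fin n → Bool,
    (∀ i, s i = true → (Finset.univ.filter fun j => s j = true ∧ M i j = true).card = 2) →
    8 * (Finset.univ.filter fun i => s i = true).card + 7 * ∑ i, slack M i ≤
      5 * n + 6 + 8 * ∑ i ∈ Finset.univ.filter fun i => s i = true, slack M i

/-- A check over all subsets. Equality holds for the 4-cycles through the vertex `4`, as 32 + 7 = 25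
+ 6 + 8, and for the triangles, as 24 + 7 = 25 + 6. -/
lemma pieceInequality_matD : PieceInequality matD := by
  unfold PieceInequality
  decide +kernel

lemma pieceInequality_matB : PieceInequality matB := by
  unfold PieceInequality
  decide +kernel

lemma pieceInequality_matK : PieceInequality matK := by
  unfold PieceInequality
  decide +kernel

lemma sum_slack_matD : ∑ i, slack matD i = 1 := by decide +kernel

lemma sum_slack_matB : ∑ i, slack matB i = 2 := by decide +kernel

lemma sum_slack_matK : ∑ i, slack matK i = 3 := by decide +kernel

/-- Parity: if `x` were also in `S`, then in the graph induced by `S ∩ A` the vertex `u` would have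
degree 1 and all others degree 2, against the handshake lemma. -/
lemma TwoReg.not_both [DecidableEq V] {S A : Finset V} {u x : V} (hS : TwoReg G S)
    (hA : IsBranch G A u x) (hu : u ∈ S) : x ∉ S := by
  classical
  intro hx
  have hfil : ∀ v ∈ S, (S.filter fun w => G.Adj v w).card = 2 := by
    intro v hv
    obtain ⟨p, hp, q, hq, hpq, h1, h2, h3⟩ := hS v hv
    rw [Finset.card_eq_two]
    refine ⟨p, q, hpq, ?_⟩
    ext z
    simp only [Finset.mem_filter, Finset.mem_insert, Finset.mem_singleton]
    constructor
    · exact fun h => h3 z h.1 h.2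
    · rintro (rfl | rfl)
      exacts [⟨hp, h1⟩, ⟨hq, h2⟩]
  set B := S ∩ A with hB
  have huB : u ∈ B := by simp [hB, hu, hA.mem]
  have hdeg : ∀ v : (B : Set V), (G.induce (B : Set V)).degree v =
      (B.filter fun w => G.Adj v w).card := by
    intro v
    rw [← card_neighborFinset_eq_degree]
    refine Finset.card_bij (fun w _ => w.1) ?_ ?_ ?_
    · intro w hw
      rw [mem_neighborFinset] at hw
      exact Finset.mem_filter.2 ⟨w.2, hw⟩
    · intro w _ w' _ h
      exact Subtype.ext h
    · intro w hw
      rw [Finset.mem_filter] at hw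
      exact ⟨⟨w, hw.1⟩, by rw [mem_neighborFinset]; exact hw.2, rfl⟩
  have h1 : (B.filter fun w => G.Adj u w).card = 1 := by
    have : B.filter (fun w => G.Adj u w) = (S.filter fun w => G.Adj u w).erase x := by
      ext w
      have h1 := hA.out u hA.mem w
      have h2 := hA.notMem
      simp only [hB, Finset.mem_filter, Finset.mem_inter, Finset.mem_erase]
      constructor
      · rintro ⟨⟨h3, h4⟩, h5⟩
        exact ⟨fun h => h2 (h ▸ h4), h3, h5⟩
      · rintro ⟨h3, h4, h5⟩
        refine ⟨⟨h4, ?_⟩, h5⟩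
        by_contra h6
        exact h3 (h1 h6 h5).2
    rw [this, Finset.card_erase_of_mem (Finset.mem_filter.2 ⟨hx, hA.adj⟩), hfil u hu]
  have h2 : ∀ v ∈ B, v ≠ u → (B.filter fun w => G.Adj v w).card = 2 := by
    intro v hv hvu
    rw [hB, Finset.mem_inter] at hv
    rw [← hfil v hv.1]
    congr 1
    ext w
    simp only [hB, Finset.mem_filter, Finset.mem_inter]
    constructor
    · rintro ⟨⟨h3, -⟩, h5⟩
      exact ⟨h3, h5⟩
    · rintro ⟨h3, h5⟩
      refine ⟨⟨h3, ?_⟩, h5⟩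
      by_contra h6
      exact hvu (hA.out v hv.2 w h6 h5).1
  have hsum := (G.induce (B : Set V)).sum_degrees_eq_twice_card_edges
  have hsum' : ∑ v : (B : Set V), (G.induce (B : Set V)).degree v =
      ∑ v ∈ B, (B.filter fun w => G.Adj v w).card := by
    rw [← Finset.sum_coe_sort B]
    exact Finset.sum_congr rfl fun v _ => hdeg v
  rw [hsum', ← Finset.add_sum_erase B _ huB, h1, Finset.sum_congr rfl fun v hv =>
    h2 v (Finset.mem_of_mem_erase hv) (Finset.ne_of_mem_erase hv), Finset.sum_const] at hsum
  simp only [smul_eq_mul] at hsum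
  omega

variable [Fintype V]

variable {W : Type*}

open Classical in
/-- The number of neighbours of `x` outside the fibre of `x`. -/
noncomputable def crossDegree (G : SimpleGraph V) (f : V → W) (x : V) : ℕ :=
  (Finset.univ.filter fun y => G.Adj x y ∧ f y ≠ f x).card

/-- The edges of `G` leaving the fibre over `w` correspond bijectively to the edges of `T` at `w`.
-/
lemma IsReplacement.degree_eq_sum [Fintype W] [DecidableEq V] [DecidableEq W] {T : SimpleGraph W}
    [DecidableRel T.Adj] {f : V → W} (h : IsReplacement T G f) (w : W) :
    T.degree w = ∑ x ∈ Finset.univ.filter fun x => f x = w, crossDegree G f x := by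
  classical
  unfold crossDegree
  rw [← Finset.card_sigma, ← card_neighborFinset_eq_degree]
  symm
  refine Finset.card_bij (fun e _ => f e.2) ?_ ?_ ?_
  · rintro ⟨x, y⟩ he
    simp only [Finset.mem_sigma, Finset.mem_filter, Finset.mem_univ, true_and] at he
    rw [mem_neighborFinset, ← he.1]
    exact h.adj_of_ne _ _ he.2.1 he.2.2.symm
  · rintro ⟨x, y⟩ he ⟨x', y'⟩ he' heq
    simp only [Finset.mem_sigma, Finset.mem_filter, Finset.mem_univ, true_and] at he he' heq
    obtain ⟨e, -, hu⟩ := h.edge w (f y) (by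
      rw [← he.1]
      exact h.adj_of_ne _ _ he.2.1 he.2.2.symm)
    have h1 := hu (x, y) ⟨he.1, rfl, he.2.1⟩
    have h2 := hu (x', y') ⟨he'.1, heq.symm, he'.2.1⟩
    have h3 := h1.trans h2.symm
    simp only [Prod.mk.injEq] at h3
    obtain ⟨rfl, rfl⟩ := h3
    rfl
  · intro z hz
    rw [mem_neighborFinset] at hz
    obtain ⟨⟨x, y⟩, ⟨h1, h2, h3⟩, -⟩ := h.edge w z hz
    refine ⟨⟨x, y⟩, ?_, h2⟩
    simp only [Finset.mem_sigma, Finset.mem_filter, Finset.mem_univ, true_and]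
    simp only at h1 h2 h3
    exact ⟨h1, h3, by rw [h1, h2]; exact hz.ne'⟩

lemma crossDegree_eq_slack [DecidableEq V] (hcub : Cubic G) {f : V → W} {w : W} {n : ℕ}
    {M : Fin n → Fin n → Bool} {g : Fin n → V} (hg : Function.Injective g)
    (hrange : Set.range g = f ⁻¹' {w}) (hadj : ∀ i j, G.Adj (g i) (g j) ↔ M i j = true) (i : Fin n) :
    crossDegree G f (g i) = slack M i := by
  classical
  have hmem : ∀ v, f v = w ↔ ∃ j, g j = v := by
    intro v
    have : v ∈ Set.range g ↔ v ∈ f ⁻¹' {w} := by rw [hrange]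
    simpa using this.symm
  have hw : f (g i) = w := (hmem _).2 ⟨i, rfl⟩
  have h3 : (Finset.univ.filter fun y => G.Adj (g i) y).card = 3 := by
    obtain ⟨x, y, z, h1, h2, h3, h4⟩ := hcub (g i)
    rw [Finset.card_eq_three]
    refine ⟨x, y, z, h1, h2, h3, ?_⟩
    ext v
    simp [h4]
  have hin : (Finset.univ.filter fun j => M i j = true).card =
      (Finset.univ.filter fun y => G.Adj (g i) y ∧ f y = w).card := by
    refine Finset.card_bij (fun j _ => g j) ?_ ?_ ?_
    · intro j hj
      simp only [Finset.mem_filter, Finset.mem_univ, true_and] at hj ⊢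
      exact ⟨(hadj _ _).2 hj, (hmem _).2 ⟨j, rfl⟩⟩
    · intro j _ j' _ h
      exact hg h
    · intro y hy
      simp only [Finset.mem_filter, Finset.mem_univ, true_and] at hy
      obtain ⟨j, rfl⟩ := (hmem y).1 hy.2
      exact ⟨j, by simpa using (hadj _ _).1 hy.1, rfl⟩
  have hsplit := Finset.card_filter_add_card_filter_not
    (s := Finset.univ.filter fun y => G.Adj (g i) y) (fun y => f y = w)
  rw [Finset.filter_filter, Finset.filter_filter, h3] at hsplit
  unfold crossDegree slack
  rw [hw, hin]
  simp only [ne_eq]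
  omega

lemma sum_crossDegree_of_copy [DecidableEq V] [DecidableEq W] (hcub : Cubic G) {f : V → W} {w : W}
    {n : ℕ} {M : Fin n → Fin n → Bool} (h : Copy G M (f ⁻¹' {w})) :
    ∑ x ∈ Finset.univ.filter (fun x => f x = w), crossDegree G f x = ∑ i, slack M i := by
  obtain ⟨g, hg, hrange, hadj⟩ := h
  have hmem : ∀ v, f v = w ↔ ∃ j, g j = v := by
    intro v
    have : v ∈ Set.range g ↔ v ∈ f ⁻¹' {w} := by rw [hrange]
    simpa using this.symm
  symm
  refine Finset.sum_bij (fun i _ => g i) ?_ ?_ ?_ ?_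
  · intro i _
    simp [hmem]
  · intro i _ j _ h
    exact hg h
  · intro v hv
    simp only [Finset.mem_filter, Finset.mem_univ, true_and] at hv
    obtain ⟨i, rfl⟩ := (hmem v).1 hv
    exact ⟨i, Finset.mem_univ _, rfl⟩
  · intro i _
    exact (crossDegree_eq_slack hcub hg hrange hadj i).symm

/-- By `hcross`, `S` has no edge between fibres, so its part in a fibre is again 2-regular and the
inequality for the matrix applies. -/
lemma Copy.inequality [DecidableEq V] [DecidableEq W] (hcub : Cubic G) {f : V → W} {w : W}
    {n : ℕ} {M : Fin n → Fin n → Bool} (h : Copy G M (f ⁻¹' {w})) (hM : PieceInequality M)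
    {S : Finset V} (hS : TwoReg G S) (hcross : ∀ x ∈ S, ∀ y ∈ S, G.Adj x y → f x = f y) :
    8 * (S.filter fun x => f x = w).card +
        7 * ∑ x ∈ Finset.univ.filter (fun x => f x = w), crossDegree G f x ≤
      5 * (Finset.univ.filter fun x => f x = w).card + 6 +
        8 * ∑ x ∈ S.filter (fun x => f x = w), crossDegree G f x := by
  rw [sum_crossDegree_of_copy hcub h]
  obtain ⟨g, hg, hrange, hadj⟩ := h
  have hmem : ∀ v, f v = w ↔ ∃ j, g j = v := by
    intro v
    have : v ∈ Set.range g ↔ v ∈ f ⁻¹' {w} := by rw [hrange]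
    simpa using this.symm
  have himg : (Finset.univ.filter fun i => decide (g i ∈ S) = true).image g =
      S.filter fun x => f x = w := by
    ext v
    simp only [Finset.mem_image, Finset.mem_filter, Finset.mem_univ, true_and, decide_eq_true_eq,
      hmem]
    constructor
    · rintro ⟨i, hi, rfl⟩
      exact ⟨hi, i, rfl⟩
    · rintro ⟨hv, i, rfl⟩
      exact ⟨i, hv, rfl⟩
  have himg' : (Finset.univ : Finset (Fin n)).image g = Finset.univ.filter fun x => f x = w := by
    ext v
    simp [hmem]
  rw [← himg, ← himg', Finset.card_image_of_injective _ hg, Finset.card_image_of_injective _ hg,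
    Finset.sum_image fun i _ j _ h => hg h, Finset.card_univ, Fintype.card_fin,
    Finset.sum_congr rfl fun i _ => crossDegree_eq_slack hcub hg hrange hadj i]
  refine hM (fun i => decide (g i ∈ S)) ?_
  intro i hi
  rw [decide_eq_true_eq] at hi
  obtain ⟨x, hx, y, hy, hxy, h1, h2, h3⟩ := hS _ hi
  have hw : f (g i) = w := (hmem _).2 ⟨i, rfl⟩
  obtain ⟨j, rfl⟩ := (hmem x).1 ((hcross _ hi _ hx h1).symm.trans hw)
  obtain ⟨k, rfl⟩ := (hmem y).1 ((hcross _ hi _ hy h2).symm.trans hw)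
  rw [Finset.card_eq_two]
  refine ⟨j, k, fun h => hxy (congrArg g h), ?_⟩
  ext l
  simp only [Finset.mem_filter, Finset.mem_univ, true_and, decide_eq_true_eq, Finset.mem_insert,
    Finset.mem_singleton, ← hadj]
  constructor
  · rintro ⟨h4, h5⟩
    exact (h3 _ h4 h5).imp (fun h => hg h) fun h => hg h
  · rintro (rfl | rfl)
    exacts [⟨hx, h1⟩, ⟨hy, h2⟩]

/-- An edge between two fibres is a bridge. -/
lemma IsReplacement.exists_isBranch {T : SimpleGraph W} {f : V → W} (h : IsReplacement T G f)
    (hT : T.IsAcyclic) {x y : V} (hxy : G.Adj x y) (hne : f x ≠ f y) : ∃ A, IsBranch G A x y := by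
  classical
  have hadj := h.adj_of_ne x y hxy hne
  have hbr := isAcyclic_iff_forall_adj_isBridge.1 hT hadj
  rw [isBridge_iff] at hbr
  -- The preimage of the side of the tree edge that contains `f x`.
  refine ⟨Finset.univ.filter fun v => (T.deleteEdges {s(f x, f y)}).Reachable (f x) (f v),
    by simp, by simpa using hbr, hxy, ?_⟩
  intro v hv w hw hvw
  simp only [Finset.mem_filter, Finset.mem_univ, true_and] at hv hw
  have hvw' : f v ≠ f w := fun h => hw (h ▸ hv)
  have hadj' := h.adj_of_ne v w hvw hvw'
  have heq : s(f v, f w) = s(f x, f y) := by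
    by_contra hs
    refine hw (hv.trans (Adj.reachable ?_))
    rw [deleteEdges_adj]
    exact ⟨hadj', hs⟩
  rw [Sym2.eq_iff] at heq
  rcases heq with ⟨h1, h2⟩ | ⟨h1, h2⟩
  · obtain ⟨e, -, hu⟩ := h.edge _ _ hadj
    have e1 := hu (v, w) ⟨h1, h2, hvw⟩
    have e2 := hu (x, y) ⟨rfl, rfl, hxy⟩
    simpa using e1.trans e2.symm
  · exact absurd (h1 ▸ hv) hbr

/-- With m vertices in `T`, the cross degrees sum to 2(m - 1), and `S` carries at most half of this.
Summing the inequalities of the pieces gives 8|S| ≤ 5n + 6m - 14(m - 1) + 8(m - 1) = 5n + 6. -/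
lemma TwoReg.card_le [Fintype W] {T : SimpleGraph W} {f : V → W} (hcub : Cubic G)
    (h : IsReplacement T G f) (hT : T.IsTree) (hP : ∀ w, IsPiece G (f ⁻¹' {w})) {S : Finset V}
    (hS : TwoReg G S) : 8 * S.card ≤ 5 * Fintype.card V + 6 := by
  classical
  have hcross : ∀ x ∈ S, ∀ y ∈ S, G.Adj x y → f x = f y := by
    intro x hx y hy hxy
    by_contra hne
    obtain ⟨A, hA⟩ := h.exists_isBranch hT.isAcyclic hxy hne
    exact hS.not_both hA hx hy
  have hfib : ∀ w, 8 * (S.filter fun x => f x = w).card +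
        7 * ∑ x ∈ Finset.univ.filter (fun x => f x = w), crossDegree G f x ≤
      5 * (Finset.univ.filter fun x => f x = w).card + 6 +
        8 * ∑ x ∈ S.filter (fun x => f x = w), crossDegree G f x := by
    intro w
    rcases hP w with h | h | h
    · exact h.inequality hcub pieceInequality_matD hS hcross
    · exact h.inequality hcub pieceInequality_matB hS hcross
    · exact h.inequality hcub pieceInequality_matK hS hcross
  have hsum := Finset.sum_le_sum fun w (_ : w ∈ Finset.univ) => hfib w
  simp only [Finset.sum_add_distrib, ← Finset.mul_sum, Finset.sum_const, smul_eq_mul,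
    Finset.card_univ] at hsum
  have e1 : ∑ w, (S.filter fun x => f x = w).card = S.card :=
    (Finset.card_eq_sum_card_fiberwise fun x _ => Finset.mem_univ (f x)).symm
  have e2 : ∑ w, (Finset.univ.filter fun x => f x = w).card = Fintype.card V :=
    (Finset.card_eq_sum_card_fiberwise fun x _ => Finset.mem_univ (f x)).symm
  have e3 : ∑ w, ∑ x ∈ S.filter (fun x => f x = w), crossDegree G f x =
      ∑ x ∈ S, crossDegree G f x := Finset.sum_fiberwise _ _ _
  have e4 : ∑ w, ∑ x ∈ Finset.univ.filter (fun x => f x = w), crossDegree G f x =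
      ∑ x, crossDegree G f x := Finset.sum_fiberwise _ _ _
  have e5 : ∑ x, crossDegree G f x + 2 = 2 * Fintype.card W := by
    rw [← e4, ← hT.card_edgeFinset, mul_add, ← T.sum_degrees_eq_twice_card_edges]
    simp only [h.degree_eq_sum]
  -- Reversing edges between fibres maps those starting in `S` injectively to those starting outside
  -- `S`.
  have e6 : ∑ x ∈ S, crossDegree G f x ≤ ∑ x ∈ Sᶜ, crossDegree G f x := by
    unfold crossDegree
    rw [← Finset.card_sigma, ← Finset.card_sigma]
    refine Finset.card_le_card_of_injOn (fun e => ⟨e.2, e.1⟩) ?_ ?_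
    · rintro ⟨x, y⟩ he
      simp only [Finset.coe_sigma, Set.mem_sigma_iff, Finset.mem_coe, Finset.mem_filter,
        Finset.mem_univ, true_and, Finset.mem_compl] at he ⊢
      exact ⟨fun hy => he.2.2 (hcross x he.1 y hy he.2.1).symm, he.2.1.symm, he.2.2.symm⟩
    · rintro ⟨x, y⟩ _ ⟨x', y'⟩ _ heq
      simp only [Sigma.mk.injEq, heq_eq_eq] at heq
      obtain ⟨rfl, rfl⟩ := heq
      rfl
  have e7 := Finset.sum_add_sum_compl S (crossDegree G f)
  rw [e1, e2, e3, e4] at hsum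
  omega

lemma ArisesFromTree.card_le (hcub : Cubic G) (h : ArisesFromTree G) {S : Finset V}
    (hS : TwoReg G S) : 8 * S.card ≤ 5 * Fintype.card V + 6 := by
  classical
  obtain ⟨m, T, f, hT, hm, hdeg, hR, h1, h2, h3⟩ := h
  refine hS.card_le hcub hR hT fun w => ?_
  have : Nontrivial (Fin m) := Fin.nontrivial_iff_two_le.2 hm
  have hpos := hT.connected.preconnected.degree_pos_of_nontrivial w
  have hle := hdeg w
  have : T.degree w = 1 ∨ T.degree w = 2 ∨ T.degree w = 3 := by
    have : T.degree w ≤ 3 := by convert hle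
    omega
  rcases this with h | h | h
  · exact Or.inl ((fibreIs_diamond'_iff f w).1 (h1 w (by convert h)))
  · exact Or.inr (Or.inl ((fibreIs_ladder''_iff f w).1 (h2 w (by convert h))))
  · exact Or.inr (Or.inr ((fibreIs_K_iff f w).1 (h3 w (by convert h))))

/-- `IsTreePart` records no degrees. They follow from cubicity: `D'`, `B_3''` and `K_3` send out
exactly 1, 2 and 3 edges. In particular no vertex of the tree is isolated, so the tree has order at
least 2. -/
lemma IsTreePart.arisesFromTree (hcub : Cubic G) (h : IsTreePart G (Finset.univ : Finset V)) :
    ArisesFromTree G := by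
  classical
  obtain ⟨W, _, T, f, hT, hP, he, ha⟩ := h
  have hW := hT.connected.nonempty
  let φ := Finite.equivFin W
  let T' := T.map φ.toEmbedding
  have hT' : T'.IsTree := (Iso.isTree_iff (Iso.map φ T)).1 hT
  have hadj : ∀ u w, T'.Adj (φ u) (φ w) ↔ T.Adj u w := fun u w => (Iso.map φ T).map_adj_iff
  have hR : IsReplacement T' G (φ ∘ f) := by
    constructor
    · intro u w huw
      obtain ⟨u, rfl⟩ := φ.surjective u
      obtain ⟨w, rfl⟩ := φ.surjective w
      simpa using he u w ((hadj u w).1 huw)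
    · intro x y hxy hne
      exact (hadj _ _).2 (ha x (Finset.mem_univ _) y (Finset.mem_univ _) hxy
        fun h => hne (congrArg φ h))
  have hP' : ∀ w, IsPiece G ((φ ∘ f) ⁻¹' {w}) := by
    intro w
    obtain ⟨w, rfl⟩ := φ.surjective w
    convert hP w using 1
    ext v
    simp
  have hd : ∀ w, (Copy G matD ((φ ∘ f) ⁻¹' {w}) ∧ T'.degree w = 1) ∨
      (Copy G matB ((φ ∘ f) ⁻¹' {w}) ∧ T'.degree w = 2) ∨
      (Copy G matK ((φ ∘ f) ⁻¹' {w}) ∧ T'.degree w = 3) := by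
    intro w
    rw [hR.degree_eq_sum w]
    rcases hP' w with h | h | h
    · exact Or.inl ⟨h, (sum_crossDegree_of_copy hcub h).trans sum_slack_matD⟩
    · exact Or.inr (Or.inl ⟨h, (sum_crossDegree_of_copy hcub h).trans sum_slack_matB⟩)
    · exact Or.inr (Or.inr ⟨h, (sum_crossDegree_of_copy hcub h).trans sum_slack_matK⟩)
  refine ⟨Nat.card W, T', φ ∘ f, hT', ?_, ?_, hR, ?_, ?_, ?_⟩
  · have hpos : 0 < T'.degree (φ hW.some) := by
      rcases hd (φ hW.some) with h | h | h <;> omega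
    obtain ⟨z, hz⟩ := (T'.degree_pos_iff_exists_adj _).1 hpos
    have := Fin.nontrivial_iff_two_le.1 ⟨_, _, hz.ne⟩
    exact this
  · intro w
    have : T'.degree w ≤ 3 := by rcases hd w with h | h | h <;> omega
    convert this
  · intro w hw
    have hw' : T'.degree w = 1 := by convert hw
    rw [fibreIs_diamond'_iff]
    rcases hd w with h | h | h
    · exact h.1
    · omega
    · omega
  · intro w hw
    have hw' : T'.degree w = 2 := by convert hw
    rw [fibreIs_ladder''_iff]
    rcases hd w with h | h | h
    · omega
    · exact h.1
    · omega
  · intro w hw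
    have hw' : T'.degree w = 3 := by convert hw
    rw [fibreIs_K_iff]
    rcases hd w with h | h | h
    · omega
    · omega
    · exact h.1

end Counting

end IndTwoReg

/-! ### The theorem. -/

theorem theorem4 {V : Type*} [Fintype V] (G : SimpleGraph V) [DecidableRel G.Adj]
    (hconn : G.Connected) (hcubic : G.IsRegularOfDegree 3)
    (hchordal : IndTwoReg.IsKChordal 4 G)
    (hK4 : IsEmpty (G ≃g IndTwoReg.K 4))
    (hK33 : IsEmpty (G ≃g IndTwoReg.K33))
    (hprism : IsEmpty (G ≃g IndTwoReg.prism)) :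
    (5 / 8 : ℝ) * (Fintype.card V : ℝ) + 3 / 4 ≤ (IndTwoReg.cInd G : ℝ) ∧
    ((IndTwoReg.cInd G : ℝ) = (5 / 8 : ℝ) * (Fintype.card V : ℝ) + 3 / 4 ↔
      IndTwoReg.ArisesFromTree G) := by
  classical
  have hcub := IndTwoReg.cubic_of_isRegularOfDegree hcubic
  obtain ⟨S, hS, hbound, hstrict⟩ :=
    IndTwoReg.exists_twoReg hconn hcub hchordal hK4 hK33 hprism
  have hle : 5 * (Fintype.card V : ℝ) + 6 ≤ 8 * S.card := by exact_mod_cast hbound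
  have hSc : (S.card : ℝ) ≤ IndTwoReg.cInd G := by exact_mod_cast hS.card_le_cInd
  refine ⟨by linarith, ?_, ?_⟩
  · intro heq
    rcases hstrict with hlt | ⟨A, u, x, hA, h₁, h₂⟩
    · have hlt : 5 * (Fintype.card V : ℝ) + 6 < 8 * S.card := by exact_mod_cast hlt
      linarith
    · apply IndTwoReg.IsTreePart.arisesFromTree hcub
      -- The bridge is the one edge along which the two tree parts are glued.
      rw [← Finset.union_compl A]
      refine h₁.glue h₂ disjoint_compl_right hA.mem (Finset.mem_compl.2 hA.notMem) hA.adj ?_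
      intro v hv w hw hvw
      exact hA.out v hv w (Finset.mem_compl.1 hw) hvw
  · intro htree
    obtain ⟨R, hR, hRc⟩ := IndTwoReg.exists_card_eq_cInd G
    have h : 8 * (R.card : ℝ) ≤ 5 * Fintype.card V + 6 := by
      exact_mod_cast htree.card_le hcub hR
    rw [hRc] at h
    linarith
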